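/- **Conventions.** A group $G$ has *decidable power coset membership problem* if $G$ is finitely generated and, with respect to a finite generating family $s_1,\dots,s_n$ of $G$, there is an algorithm that, given words in the letters $s_i^{\pm1}$ representing elements $x,g\in G$ and $h_1,\dots,h_k\in G$, decides whether there is a non-zero integer $m$ with $g^m\in xH$, where $H=\langle h_1,\dots,h_k\rangle$. (This does not depend on the choice of the finite generating family.) A *graph* consists of a set $V$ of vertices, a set $E$ of edges, maps $o,t:E\to V$, and a fixed-point free involution $e\mapsto e^{-1}$ of $E$ with $o(e)=t(e^{-1})$. A *graph of groups* $\mathbb A$ consists of a graph together with a group $A_v$ for each vertex $v$, a group $A_e$ for each edge $e$, with $A_{e^{-1}}=A_e$, and monomorphisms $\alpha_e:A_e\to A_{o(e)}$ and $\omega_e:A_e\to A_{t(e)}$ with $\alpha_{e^{-1}}=\omega_e$. For a vertex $v_0$, the *fundamental group* $\pi_1(\mathbb A,v_0)$ is the group, under concatenation, of equivalence classes of loops $\langle p_0,e_1,p_1,\dots,e_n,p_n\rangle$ based at $v_0$ (where $(e_1,\dots,e_n)$ is an edge path from $v_0$ to $v_0$, $p_0\in A_{v_0}$ and $p_i\in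 A_{t(e_i)}$); the equivalence relation is generated by the elementary reductions, which replace a subpath $\langle a,e,\omega_e(c),e^{-1},b\rangle$ with $c\in A_e$ by $\langle a\,\alpha_e(c)\,b\rangle$. **Statement.** Let $\mathbb A$ be a graph of groups whose underlying graph has finitely many vertices and edges, and let $v_0$ be a vertex. Suppose that every edge group of $\mathbb A$ is finite and that every vertex group of $\mathbb A$ is finitely generated and has decidable power coset membership problem. Then $G=\pi_1(\mathbb A,v_0)$ is finitely generated and has decidable power coset membership problem. -/

import Mathlib

open scoped Pointwise

universe u v w x

/-! ### Graphs of groups -/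

/-- A graph in the sense of Serre: a set `V` of vertices, sets `a ⟶ b` of edges `e` with `o(e) = a`
and `t(e) = b`, and a fixed-point free involution `e ↦ e⁻¹` (written `Quiver.reverse e`) exchanging
origin and terminus. Loops and multiple edges are allowed. -/
class SerreGraph (V : Type u) extends Quiver.{v} V, Quiver.HasInvolutiveReverse V where
  /-- No edge is its own inverse. (An edge `e` with `e⁻¹ = e` must have equal endpoints.) -/
  reverse_ne : ∀ {a : V} (e : a ⟶ a), Quiver.reverse e ≠ e

/-- A graph of groups with underlying graph `V`: a group for each vertex, a group for each edge and,
for each edge `e`, monomorphisms `α e`, `ω e` from the edge group to the vertex groups at the origin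
and at the terminus of `e`. The edge groups of `e` and `e⁻¹` are identified through `rev e`, and
under this identification `α e⁻¹ = ω e` and `ω e⁻¹ = α e`. -/
structure GraphOfGroups (V : Type u) [SerreGraph.{u, v} V] where
  /-- The vertex groups. -/
  vertexGroup : V → Type w
  [vertexInst : ∀ a, Group (vertexGroup a)]
  /-- The edge groups. -/
  edgeGroup : ∀ {a b : V}, (a ⟶ b) → Type x
  [edgeInst : ∀ {a b : V} (e : a ⟶ b), Group (edgeGroup e)]
  /-- The boundary monomorphism into the vertex group at the origin. -/
  α : ∀ {a b : V} (e : a ⟶ b), edgeGroup e →* vertexGroup a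
  /-- The boundary monomorphism into the vertex group at the terminus. -/
  ω : ∀ {a b : V} (e : a ⟶ b), edgeGroup e →* vertexGroup b
  α_injective : ∀ {a b : V} (e : a ⟶ b), Function.Injective (α e)
  ω_injective : ∀ {a b : V} (e : a ⟶ b), Function.Injective (ω e)
  /-- The identification of the edge group of `e` with the edge group of `e⁻¹`. -/
  rev : ∀ {a b : V} (e : a ⟶ b), edgeGroup e ≃* edgeGroup (Quiver.reverse e)
  α_rev : ∀ {a b : V} (e : a ⟶ b) (c : edgeGroup e), α (Quiver.reverse e) (rev e c) = ω e c
  ω_rev : ∀ {a b : V} (e : a ⟶ b) (c : edgeGroup e), ω (Quiver.reverse e) (rev e c) = α e c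

namespace GraphOfGroups

variable {V : Type u} [SerreGraph.{u, v} V] (A : GraphOfGroups.{u, v, w, x} V)

instance instGroupVertexGroup (a : V) : Group (A.vertexGroup a) := A.vertexInst a

instance instGroupEdgeGroup {a b : V} (e : a ⟶ b) : Group (A.edgeGroup e) := A.edgeInst e

/-- Paths `⟨p₀, e₁, p₁, …, eₙ, pₙ⟩` in a graph of groups, from a vertex `a` to a vertex `b`: an edge
path `e₁, …, eₙ` from `a` to `b`, with `p₀` in the group of `a` and `pᵢ` in the group of the
terminus of `eᵢ`. -/
inductive GPath : V → V → Type (max u v w)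
  /-- The path `⟨g⟩` without edges. -/
  | nil {a : V} (g : A.vertexGroup a) : GPath a a
  /-- The path `⟨g, e, p₀, e₁, p₁, …⟩`, where `p = ⟨p₀, e₁, p₁, …⟩`. -/
  | cons {a b c : V} (g : A.vertexGroup a) (e : a ⟶ b) (p : GPath b c) : GPath a c

namespace GPath

variable {A}

/-- `g · ⟨p₀, e₁, p₁, …⟩ = ⟨g p₀, e₁, p₁, …⟩`. -/
def lmul : {a b : V} → A.vertexGroup a → A.GPath a b → A.GPath a b
  | _, _, g, nil h => nil (g * h)
  | _, _, g, cons h e p => cons (g * h) e p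

/-- Concatenation:
`⟨p₀, e₁, …, eₙ, pₙ⟩ ⟨q₀, f₁, …, q_m⟩ = ⟨p₀, e₁, …, eₙ, pₙ q₀, f₁, …, q_m⟩`. -/
def append : {a b c : V} → A.GPath a b → A.GPath b c → A.GPath a c
  | _, _, _, nil g, q => lmul g q
  | _, _, _, cons g e p, q => cons g e (append p q)

/-- The inverse path `⟨pₙ⁻¹, eₙ⁻¹, …, e₁⁻¹, p₀⁻¹⟩`. -/
def inv : {a b : V} → A.GPath a b → A.GPath b a
  | _, _, nil g => nil g⁻¹
  | _, _, cons g e p => append (inv p) (cons 1 (Quiver.reverse e) (nil g⁻¹))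

/-- Elementary reductions: a subpath `⟨g, e, ω e c, e⁻¹, h⟩`, at any place of a path, is replaced
by `⟨g (α e c) h⟩`. -/
inductive Red : {a b : V} → A.GPath a b → A.GPath a b → Prop
  /-- The reduction takes place at the first edge of the path. -/
  | head {a b d : V} (g : A.vertexGroup a) (e : a ⟶ b) (c : A.edgeGroup e) (p : A.GPath a d) :
      Red (cons g e (cons (A.ω e c) (Quiver.reverse e) p)) (lmul (g * A.α e c) p)
  /-- The reduction takes place after the first edge of the path. -/
  | tail {a b d : V} (g : A.vertexGroup a) (e : a ⟶ b) {p q : A.GPath b d} :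
      Red p q → Red (cons g e p) (cons g e q)

/-- The equivalence relation on paths generated by the elementary reductions. -/
def Equiv {a b : V} (p q : A.GPath a b) : Prop := Relation.EqvGen Red p q

theorem Equiv.refl {a b : V} (p : A.GPath a b) : Equiv p p := Relation.EqvGen.refl p

theorem Equiv.symm {a b : V} {p q : A.GPath a b} (h : Equiv p q) : Equiv q p :=
  Relation.EqvGen.symm _ _ h

theorem Equiv.trans {a b : V} {p q r : A.GPath a b} (h : Equiv p q) (h' : Equiv q r) :
    Equiv p r :=
  Relation.EqvGen.trans _ _ _ h h'

theorem Red.equiv {a b : V} {p q : A.GPath a b} (h : Red p q) : Equiv p q :=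
  Relation.EqvGen.rel _ _ h

theorem Equiv.map {a b c d : V} (f : A.GPath a b → A.GPath c d)
    (hf : ∀ p q, Red p q → Red (f p) (f q)) {p q : A.GPath a b} (h : Equiv p q) :
    Equiv (f p) (f q) := by
  induction h with
  | rel p q h => exact (hf p q h).equiv
  | refl p => exact Equiv.refl _
  | symm p q _ ih => exact ih.symm
  | trans p q r _ _ ih₁ ih₂ => exact ih₁.trans ih₂

theorem lmul_cons {a b c : V} (g h : A.vertexGroup a) (e : a ⟶ b) (p : A.GPath b c) :
    lmul g (cons h e p) = cons (g * h) e p := rfl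

theorem lmul_lmul {a b : V} (g h : A.vertexGroup a) (p : A.GPath a b) :
    lmul g (lmul h p) = lmul (g * h) p := by
  cases p <;> simp [lmul, mul_assoc]

theorem one_lmul {a b : V} (p : A.GPath a b) : lmul 1 p = p := by
  cases p <;> simp [lmul]

theorem lmul_append {a b c : V} (g : A.vertexGroup a) (p : A.GPath a b) (q : A.GPath b c) :
    append (lmul g p) q = lmul g (append p q) := by
  cases p with
  | nil h => exact (lmul_lmul g h q).symm
  | cons h e p => rfl

theorem append_assoc {a b c d : V} (p : A.GPath a b) (q : A.GPath b c) (r : A.GPath c d) :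
    append (append p q) r = append p (append q r) := by
  induction p with
  | nil g => simp [append, lmul_append]
  | cons g e p ih => simp [append, ih]

theorem append_one {a b : V} (p : A.GPath a b) : append p (nil 1) = p := by
  induction p with
  | nil g => simp [append, lmul]
  | cons g e p ih => simp [append, ih]

theorem Red.lmul {a b : V} (g : A.vertexGroup a) {p q : A.GPath a b} (h : Red p q) :
    Red (lmul g p) (lmul g q) := by
  cases h with
  | head k e c p =>
    have := Red.head (g * k) e c p
    rw [lmul_cons, lmul_lmul, ← mul_assoc]
    exact this
  | tail k e h => exact Red.tail (g * k) e h

theorem Red.append_left {a b c : V} (p : A.GPath a b) {q r : A.GPath b c} (h : Red q r) :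
    Red (append p q) (append p r) := by
  induction p with
  | nil g => exact h.lmul g
  | cons g e p ih => exact Red.tail g e (ih h)

theorem Red.append_right {a b c : V} {p q : A.GPath a b} (h : Red p q) (r : A.GPath b c) :
    Red (append p r) (append q r) := by
  induction h with
  | head g e c p =>
    rw [lmul_append]
    exact Red.head g e c (append p r)
  | tail g e _ ih => exact Red.tail g e (ih r)

theorem Equiv.append {a b c : V} {p p' : A.GPath a b} {q q' : A.GPath b c}
    (hp : Equiv p p') (hq : Equiv q q') : Equiv (append p q) (append p' q') :=
  (hp.map (fun r => GPath.append r q) fun _ _ h => h.append_right q).trans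
    (hq.map (fun r => GPath.append p' r) fun _ _ h => h.append_left p')

theorem append_inv {a b : V} (p : A.GPath a b) : Equiv (append p (inv p)) (nil 1) := by
  induction p with
  | nil g => simpa [append, inv, lmul] using Equiv.refl _
  | @cons a b d g e p ih =>
    have h₁ : Equiv (append (append p (inv p)) (cons 1 (Quiver.reverse e) (nil g⁻¹)))
        (cons (A.ω e 1) (Quiver.reverse e) (nil g⁻¹)) := by
      have := ih.append (Equiv.refl (cons 1 (Quiver.reverse e) (nil g⁻¹)))
      simpa [append, lmul] using this
    have h₂ := h₁.map (cons g e) fun _ _ h => Red.tail g e h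
    have h₃ := h₂.trans (Red.head g e 1 (nil g⁻¹)).equiv
    simpa [append, inv, lmul, append_assoc] using h₃

theorem inv_append {a b : V} (p : A.GPath a b) : Equiv (append (inv p) p) (nil 1) := by
  induction p with
  | nil g => simpa [append, inv, lmul] using Equiv.refl _
  | @cons a b d g e p ih =>
    have h := Red.head (1 : A.vertexGroup b) (Quiver.reverse e) 1 p
    rw [Quiver.reverse_reverse] at h
    have h₂ := (h.append_left (inv p)).equiv.trans (by simpa [one_lmul] using ih)
    simpa [append, inv, lmul, append_assoc] using h₂

theorem Equiv.inv {a b : V} {p q : A.GPath a b} (h : Equiv p q) :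
    Equiv (inv p) (inv q) := by
  have h₁ : Equiv (GPath.inv p) (GPath.append (GPath.inv p) (GPath.append q (GPath.inv q))) := by
    have := (Equiv.refl (GPath.inv p)).append (append_inv q)
    rw [append_one] at this
    exact this.symm
  have h₂ : Equiv (GPath.append (GPath.append (GPath.inv p) q) (GPath.inv q)) (GPath.inv q) := by
    have h₃ : Equiv (GPath.append (GPath.inv p) q) (nil 1) :=
      ((Equiv.refl (GPath.inv p)).append h.symm).trans (inv_append p)
    have := h₃.append (Equiv.refl (GPath.inv q))
    simpa [GPath.append, one_lmul] using this
  rw [append_assoc] at h₂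
  exact h₁.trans h₂

end GPath

/-- Equivalence of loops based at `v₀`. -/
def loopSetoid (v₀ : V) : Setoid (A.GPath v₀ v₀) where
  r := GPath.Equiv
  iseqv := ⟨GPath.Equiv.refl, GPath.Equiv.symm, GPath.Equiv.trans⟩

/-- The fundamental group `π₁(A, v₀)` of a graph of groups: equivalence classes of loops based at
`v₀`, with concatenation. -/
def FundamentalGroup (v₀ : V) : Type (max u v w) := Quotient (A.loopSetoid v₀)

instance instGroupFundamentalGroup (v₀ : V) : Group (A.FundamentalGroup v₀) where
  mul := Quotient.map₂ GPath.append fun _ _ hp _ _ hq => GPath.Equiv.append hp hq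
  one := Quotient.mk _ (GPath.nil 1)
  inv := Quotient.map GPath.inv fun _ _ h => GPath.Equiv.inv h
  mul_assoc := by
    rintro ⟨p⟩ ⟨q⟩ ⟨r⟩
    exact congrArg (Quotient.mk _) (GPath.append_assoc p q r)
  one_mul := by
    rintro ⟨p⟩
    exact congrArg (Quotient.mk _) (GPath.one_lmul p)
  mul_one := by
    rintro ⟨p⟩
    exact congrArg (Quotient.mk _) (GPath.append_one p)
  inv_mul_cancel := by
    rintro ⟨p⟩
    exact Quotient.sound (GPath.inv_append p)

end GraphOfGroups

/-! ### The power coset membership problem -/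

/-- The element of `G` that is represented by a word in the letters `sᵢ` (coded `(i, true)`) and
`sᵢ⁻¹` (coded `(i, false)`). -/
def wordValue {G : Type*} [Group G] {n : ℕ} (s : Fin n → G) (l : List (Fin n × Bool)) : G :=
  (l.map fun a => if a.2 then s a.1 else (s a.1)⁻¹).prod

/-- The instance `(x, g, L)` of the power coset membership problem, where `x`, `g` and the members
of `L` are words in the letters `sᵢ`, `sᵢ⁻¹`, has the answer "yes": there is a non-zero integer `m`
with `g ^ m ∈ x H`, where `H` is the subgroup generated by the elements that `L` represents. -/
def PowerCosetInstance {G : Type*} [Group G] {n : ℕ} (s : Fin n → G)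
    (I : List (Fin n × Bool) × List (Fin n × Bool) × List (List (Fin n × Bool))) : Prop :=
  ∃ m : ℤ, m ≠ 0 ∧
    wordValue s I.2.1 ^ m ∈
      wordValue s I.1 • (Subgroup.closure {h | ∃ l ∈ I.2.2, wordValue s l = h} : Set G)

/-- `G` is finitely generated and its power coset membership problem is decidable: for a finite
generating family of `G`, there is an algorithm that decides the problem, its inputs being given as
words in the generators. (Rewriting words shows that the choice of the finite generating family is
immaterial.) -/
def DecidablePowerCosetMembership (G : Type*) [Group G] : Prop :=
  ∃ (n : ℕ) (s : Fin n → G), Subgroup.closure (Set.range s) = ⊤ ∧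
    ComputablePred (PowerCosetInstance s)

/-!
The yes-instances and the no-instances of the problem are both recursively enumerable.

Equality of words is recursively enumerable, because consequences of the relators of the vertex
groups and of the elementary reductions can be listed; so one can search for an exponent and an
element of `H` that witness `g ^ m ∈ x H`.

A no-instance is certified by a finite piece of the space of the cosets of `H`, on which the graph
of groups acts partially: a vertex group through finitely many of its own coset spaces, an edge by
finitely many arrows. As the edge groups are finite, whether such a piece is consistent comes down
to finitely many questions about cosets in vertex groups. The element `g` is conjugate to a
cyclically reduced loop `c`. If `c` has no edge, it lies in a vertex group and the algorithm of that
group decides. Otherwise the powers of `c` are reduced paths; a piece that lets a path act lets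
every equivalent reduced path act in the same way, so it suffices that the powers of `c`, traced in
the piece, miss the forbidden coset. Only finitely many points of a piece can occur just after an
edge, so finitely many traces cover all powers, and finitely many arrows of the full coset space
suffice for the certificate.
-/

/-! ### Recursively enumerable predicates -/

section RecursivelyEnumerable

variable {α β γ σ : Type*} [Primcodable α] [Primcodable β] [Primcodable γ] [Primcodable σ]

theorem primrec_fst_comp {f : α → β × γ} (hf : Primrec f) : Primrec fun a => (f a).1 :=
  Primrec.fst.comp hf

theorem primrec_snd_comp {f : α → β × γ} (hf : Primrec f) : Primrec fun a => (f a).2 :=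
  Primrec.snd.comp hf

theorem primrec_append_comp {f g : α → List β} (hf : Primrec f) (hg : Primrec g) :
    Primrec fun a => f a ++ g a :=
  Primrec.list_append.comp hf hg

theorem primrec_flatten_comp {f : α → List (List β)} (hf : Primrec f) :
    Primrec fun a => (f a).flatten :=
  Primrec.list_flatten.comp hf

theorem primrec_cons_comp {f : α → β} {g : α → List β} (hf : Primrec f) (hg : Primrec g) :
    Primrec fun a => f a :: g a :=
  Primrec.list_cons.comp hf hg

theorem primrec_some_comp {f : α → β} (hf : Primrec f) : Primrec fun a => some (f a) :=
  Primrec.option_some.comp hf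

theorem primrec_inl_comp {f : α → β} (hf : Primrec f) :
    Primrec fun a => (Sum.inl (f a) : β ⊕ γ) :=
  Primrec.sumInl.comp hf

theorem primrec_inr_comp {f : α → γ} (hf : Primrec f) :
    Primrec fun a => (Sum.inr (f a) : β ⊕ γ) :=
  Primrec.sumInr.comp hf

attribute [fun_prop] Primrec Primrec.id Primrec.const Primrec.comp Primrec.pair primrec_fst_comp
  primrec_snd_comp primrec_append_comp primrec_flatten_comp primrec_cons_comp primrec_some_comp
  primrec_inl_comp primrec_inr_comp

attribute [fun_prop] Computable Computable.id Computable.const Computable.comp Primrec.to_comp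

theorem exists_primrecRel_of_rePred {p : α → Prop} (h : REPred p) :
    ∃ R : α → ℕ → Prop, PrimrecRel R ∧ ∀ a, p a ↔ ∃ n, R a n := by
  obtain ⟨c, hc⟩ := Nat.Partrec.Code.exists_code.1 h
  refine ⟨fun a k => (Nat.Partrec.Code.evaln k c (Encodable.encode a)).isSome = true, ?_, ?_⟩
  · have hevaln : Primrec fun x : α × ℕ => Nat.Partrec.Code.evaln x.2 c (Encodable.encode x.1) :=
      Nat.Partrec.Code.primrec_evaln.comp
        ((Primrec.snd.pair (Primrec.const c)).pair (Primrec.encode.comp Primrec.fst))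
    exact Primrec.eq.comp (Primrec.option_isSome.comp hevaln) (Primrec.const true)
  · intro a
    have hdom : p a ↔ (Nat.Partrec.Code.eval c (Encodable.encode a)).Dom := by
      rw [hc]
      simp [Part.assert]
    simp only [hdom, Part.dom_iff_mem, Nat.Partrec.Code.evaln_complete, Option.isSome_iff_exists,
      Option.mem_def]
    exact exists_comm

theorem rePred_exists_of_primrecRel {R : α → ℕ → Prop} (hR : PrimrecRel R) :
    REPred fun a => ∃ n, R a n := by
  obtain ⟨d, hd⟩ := hR
  have (a : α) (n : ℕ) : Decidable (R a n) := d (a, n)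
  have hsearch : Partrec₂ fun (a : α) (n : ℕ) => (Part.some (decide (R a n)) : Part Bool) :=
    Computable.partrec (hd.to_comp.of_eq fun x => by congr)
  refine (Partrec.rfind hsearch).dom_re.of_eq fun a => ?_
  refine Nat.rfind_dom'.trans (exists_congr fun n => ?_)
  simp

theorem rePred_of_primrecPred {p : α → Prop} (h : PrimrecPred p) : REPred p :=
  h.computablePred.to_re

theorem rePred_comp {p : β → Prop} (h : REPred p) {f : α → β} (hf : Computable f) :
    REPred fun a => p (f a) :=
  Partrec.comp h hf

theorem rePred_eq {f g : α → β} (hf : Computable f) (hg : Computable g) :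
    REPred fun a => f a = g a :=
  rePred_comp (rePred_of_primrecPred Primrec.eq) (hf.pair hg)

theorem rePred_ne {f g : α → β} (hf : Computable f) (hg : Computable g) :
    REPred fun a => f a ≠ g a :=
  rePred_comp (rePred_of_primrecPred Primrec.eq.not) (hf.pair hg)

theorem rePred_exists {p : α → β → Prop} (h : REPred fun x : α × β => p x.1 x.2) :
    REPred fun a => ∃ b, p a b := by
  obtain ⟨R, hR, hp⟩ := exists_primrecRel_of_rePred h
  have hsearch : PrimrecRel fun (a : α) (n : ℕ) =>
      ∃ b ∈ (Encodable.decode (α := β) n.unpair.1).toList, R (a, b) n.unpair.2 := by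
    have hR' : PrimrecRel fun (b : β) (x : α × ℕ) => R (x.1, b) x.2 :=
      hR.comp (by fun_prop) (by fun_prop)
    refine hR'.exists_mem_list.comp (f := fun x : α × ℕ => _)
      (g := fun x : α × ℕ => (x.1, x.2.unpair.2)) ?_ ?_
    · exact Primrec.optionToList.comp (Primrec.decode.comp
        (Primrec.fst.comp (Primrec.unpair.comp Primrec.snd)))
    · exact Primrec.fst.pair (Primrec.snd.comp (Primrec.unpair.comp Primrec.snd))
  refine (rePred_exists_of_primrecRel hsearch).of_eq fun a => ?_
  constructor
  · rintro ⟨n, b, -, hb⟩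
    exact ⟨b, (hp (a, b)).2 ⟨_, hb⟩⟩
  · rintro ⟨b, hb⟩
    obtain ⟨n, hn⟩ := (hp (a, b)).1 hb
    exact ⟨Nat.pair (Encodable.encode b) n, b, by simp, by simpa using hn⟩

theorem rePred_and {p q : α → Prop} (hp : REPred p) (hq : REPred q) :
    REPred fun a => p a ∧ q a := by
  obtain ⟨R, hR, hp⟩ := exists_primrecRel_of_rePred hp
  obtain ⟨S, hS, hq⟩ := exists_primrecRel_of_rePred hq
  have hRS : REPred fun a => ∃ x : ℕ × ℕ, R a x.1 ∧ S a x.2 :=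
    rePred_exists (rePred_of_primrecPred
      ((hR.comp Primrec.fst (Primrec.fst.comp Primrec.snd)).and
        (hS.comp Primrec.fst (Primrec.snd.comp Primrec.snd))))
  refine hRS.of_eq fun a => ?_
  simp only [hp, hq, Prod.exists, exists_and_left, exists_and_right]

theorem rePred_or {p q : α → Prop} (hp : REPred p) (hq : REPred q) :
    REPred fun a => p a ∨ q a := by
  obtain ⟨R, hR, hp⟩ := exists_primrecRel_of_rePred hp
  obtain ⟨S, hS, hq⟩ := exists_primrecRel_of_rePred hq
  refine (rePred_exists_of_primrecRel (R := fun a n => R a n ∨ S a n)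
    (PrimrecPred.or hR hS)).of_eq fun a => ?_
  simp only [hp, hq, exists_or]

theorem rePred_imp {p q : α → Prop} (hp : REPred fun a => ¬ p a) (hq : REPred q) :
    REPred fun a => p a → q a :=
  (rePred_or hp hq).of_eq fun _ => imp_iff_not_or.symm

theorem rePred_sum {p : α → β ⊕ γ → Prop} (hl : REPred fun x : α × β => p x.1 (Sum.inl x.2))
    (hr : REPred fun x : α × γ => p x.1 (Sum.inr x.2)) {f : α → β ⊕ γ} (hf : Computable f) :
    REPred fun a => p a (f a) := by
  have hl' := rePred_exists (p := fun a b => f a = Sum.inl b ∧ p a (Sum.inl b))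
    (rePred_and (rePred_eq (hf.comp Computable.fst) (by fun_prop)) hl)
  have hr' := rePred_exists (p := fun a c => f a = Sum.inr c ∧ p a (Sum.inr c))
    (rePred_and (rePred_eq (hf.comp Computable.fst) (by fun_prop)) hr)
  refine (rePred_or hl' hr').of_eq fun a => ?_
  cases f a <;> simp

theorem rePred_option {p : α → Option β → Prop} (hnone : REPred fun a => p a none)
    (hsome : REPred fun x : α × β => p x.1 (some x.2)) {f : α → Option β} (hf : Computable f) :
    REPred fun a => p a (f a) := by
  have hsome' := rePred_exists (p := fun a b => f a = some b ∧ p a (some b))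
    (rePred_and (rePred_eq (hf.comp Computable.fst) (by fun_prop)) hsome)
  refine (rePred_or (rePred_and (rePred_eq hf (Computable.const none)) hnone) hsome').of_eq
    fun a => ?_
  cases f a <;> simp

theorem rePred_forall_mem {p : α → β → Prop} {f : α → List β}
    (h : REPred fun x : α × β => p x.1 x.2) (hf : Computable f) :
    REPred fun a => ∀ b ∈ f a, p a b := by
  obtain ⟨R, hR, hp⟩ := exists_primrecRel_of_rePred h
  have hbounded : PrimrecRel fun (x : α × List β) (N : ℕ) =>
      ∀ b ∈ x.2, ∃ n ∈ List.range N, R (x.1, b) n := by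
    have hR' : PrimrecRel fun (n : ℕ) (x : α × β) => R x n := hR.comp Primrec.snd Primrec.fst
    have hexists : PrimrecRel fun (b : β) (x : α × ℕ) => ∃ n ∈ List.range x.2, R (x.1, b) n :=
      PrimrecRel.comp (R := fun (l : List ℕ) x => ∃ n ∈ l, R x n)
        (f := fun y : β × α × ℕ => List.range y.2.2) (g := fun y => (y.2.1, y.1))
        hR'.exists_mem_list (Primrec.list_range.comp (by fun_prop)) (by fun_prop)
    exact PrimrecRel.comp
      (R := fun (l : List β) (x : α × ℕ) => ∀ b ∈ l, ∃ n ∈ List.range x.2, R (x.1, b) n)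
      (f := fun y : (α × List β) × ℕ => y.1.2) (g := fun y => (y.1.1, y.2))
      hexists.forall_mem_list (by fun_prop) (by fun_prop)
  refine (rePred_comp (rePred_exists_of_primrecRel hbounded)
    (Computable.id.pair hf)).of_eq fun a => ?_
  constructor
  · rintro ⟨N, h⟩ b hb
    obtain ⟨n, -, hn⟩ := h b hb
    exact (hp (a, b)).2 ⟨n, hn⟩
  · intro h
    choose! n hn using fun b hb => (hp (a, b)).1 (h b hb)
    refine ⟨((f a).map n).sum + 1, fun b hb => ⟨n b, ?_, hn b hb⟩⟩
    rw [List.mem_range]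
    exact Nat.lt_succ_of_le (List.le_sum_of_mem (List.mem_map_of_mem hb))

theorem rePred_forall_finite [Finite β] {p : α → β → Prop}
    (h : REPred fun x : α × β => p x.1 x.2) : REPred fun a => ∀ b, p a b := by
  have := Fintype.ofFinite β
  refine (rePred_forall_mem h (Computable.const (Finset.univ : Finset β).toList)).of_eq fun a => ?_
  simp

theorem rePred_mem {f : α → List β} {g : α → β} (hf : Computable f) (hg : Computable g) :
    REPred fun a => g a ∈ f a := by
  have hsearch : REPred fun a => ∃ n : ℕ, (f a)[n]? = some (g a) :=
    rePred_exists (rePred_eq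
      (Computable.list_getElem?.comp (hf.comp Computable.fst) Computable.snd)
      (Computable.option_some.comp (hg.comp Computable.fst)))
  exact hsearch.of_eq fun a => List.mem_iff_getElem?.symm

theorem rePred_uncurry_of_finite [Finite β] {p : α → β → Prop} (h : ∀ b, REPred fun a => p a b) :
    REPred fun x : α × β => p x.1 x.2 := by
  classical
  have := Fintype.ofFinite β
  suffices hs : ∀ s : Finset β, REPred fun x : α × β => ∃ b ∈ s, x.2 = b ∧ p x.1 b from
    (hs Finset.univ).of_eq fun x => by simp
  intro s
  induction s using Finset.induction_on with
  | empty =>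
    exact (rePred_ne (Computable.const ()) (Computable.const ()) : REPred fun _ : α × β =>
      () ≠ ()).of_eq fun x => by simp
  | insert b s _ ih =>
    refine (rePred_or (rePred_and (rePred_eq Computable.snd (Computable.const b))
      (rePred_comp (h b) Computable.fst)) ih).of_eq fun x => ?_
    simp only [Finset.mem_insert, exists_eq_or_imp]

end RecursivelyEnumerable

/-! ### Runs of nondeterministic machines -/

section Run

variable {σ β : Type*}

/-- `Run R s l s'`: a machine with the transitions `R` can pass from the state `s` to the state
`s'` by reading `l`. -/
inductive Run (R : σ → β → σ → Prop) : σ → List β → σ → Prop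
  | nil (s : σ) : Run R s [] s
  | cons {s s' s'' : σ} {b : β} {l : List β} : R s b s' → Run R s' l s'' → Run R s (b :: l) s''

theorem run_nil_iff {R : σ → β → σ → Prop} {s s' : σ} : Run R s [] s' ↔ s = s' :=
  ⟨fun h => by cases h; rfl, fun h => h ▸ Run.nil s⟩

theorem run_cons_iff {R : σ → β → σ → Prop} {s s' : σ} {b : β} {l : List β} :
    Run R s (b :: l) s' ↔ ∃ t, R s b t ∧ Run R t l s' :=
  ⟨fun h => by cases h; exact ⟨_, ‹_›, ‹_›⟩, fun ⟨_, h, h'⟩ => Run.cons h h'⟩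

theorem run_append_iff {R : σ → β → σ → Prop} {l l' : List β} {s s' : σ} :
    Run R s (l ++ l') s' ↔ ∃ t, Run R s l t ∧ Run R t l' s' := by
  induction l generalizing s with
  | nil => simp [run_nil_iff]
  | cons b l ih =>
    simp only [List.cons_append, run_cons_iff, ih]
    exact ⟨fun ⟨t, h, t', h', h''⟩ => ⟨t', ⟨t, h, h'⟩, h''⟩,
      fun ⟨t', ⟨t, h, h'⟩, h''⟩ => ⟨t, h, t', h', h''⟩⟩

/-- The first state and the input of a run that ends in `s` and consists of the transitions
`(s₀, b, s₁)` in the list; `none` if consecutive transitions do not fit together. -/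
def runStart [DecidableEq σ] (s : σ) : List (σ × β × σ) → Option (σ × List β)
  | [] => some (s, [])
  | t :: T => (runStart s T).bind fun y => if y.1 = t.2.2 then some (t.1, t.2.1 :: y.2) else none

theorem run_iff_exists_runStart [DecidableEq σ] {R : σ → β → σ → Prop} {l : List β} {s s' : σ} :
    Run R s l s' ↔
      ∃ T : List (σ × β × σ), (∀ t ∈ T, R t.1 t.2.1 t.2.2) ∧ runStart s' T = some (s, l) := by
  constructor
  · intro h
    induction h with
    | nil s => exact ⟨[], by simp, rfl⟩
    | @cons s t s' b l h _ ih =>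
      obtain ⟨T, hT, hstart⟩ := ih
      exact ⟨(s, b, t) :: T, by simpa [h] using hT, by simp [runStart, hstart]⟩
  · rintro ⟨T, hT, hstart⟩
    induction T generalizing s l with
    | nil =>
      obtain ⟨rfl, rfl⟩ : s' = s ∧ [] = l := by simpa [runStart] using hstart
      exact Run.nil _
    | cons t T ih =>
      rw [List.forall_mem_cons] at hT
      obtain ⟨y, hy, hy'⟩ := Option.bind_eq_some_iff.1 hstart
      split_ifs at hy' with hmatch
      obtain ⟨rfl, rfl⟩ : t.1 = s ∧ t.2.1 :: y.2 = l := by simpa using hy'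
      exact Run.cons hT.1 (hmatch ▸ ih hT.2 hy)

theorem primrec_runStart [DecidableEq σ] [Primcodable σ] [Primcodable β] :
    Primrec₂ (runStart : σ → List (σ × β × σ) → Option (σ × List β)) := by
  have hstep : Primrec fun x : (σ × List (σ × β × σ)) × (σ × β × σ) × Option (σ × List β) =>
      x.2.2.bind fun y => if y.1 = x.2.1.2.2 then some (x.2.1.1, x.2.1.2.1 :: y.2) else none := by
    refine Primrec.option_bind (by fun_prop)
      (Primrec.ite (Primrec.eq.comp ?_ ?_) ?_ ?_) <;> fun_prop
  refine (Primrec.list_foldr (f := fun x : σ × List (σ × β × σ) => x.2)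
    (g := fun x => some (x.1, [])) (by fun_prop) (by fun_prop) hstep.to₂).of_eq fun x => ?_
  induction x.2 with
  | nil => rfl
  | cons t T ih => simp only [List.foldr_cons, runStart, ih]

theorem rePred_run {α : Type*} [Primcodable α] [Primcodable σ] [Primcodable β]
    {R : α → σ → β → σ → Prop} (h : REPred fun x : α × σ × β × σ => R x.1 x.2.1 x.2.2.1 x.2.2.2)
    {f g : α → σ} {l : α → List β} (hf : Computable f) (hl : Computable l) (hg : Computable g) :
    REPred fun a => Run (R a) (f a) (l a) (g a) := by
  classical
  simp only [run_iff_exists_runStart]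
  refine rePred_exists (rePred_and ?_ (rePred_eq ?_ ?_))
  · exact rePred_forall_mem (p := fun (x : α × List (σ × β × σ)) t => R x.1 t.1 t.2.1 t.2.2)
      (rePred_comp h (f := fun x : (α × List (σ × β × σ)) × σ × β × σ => (x.1.1, x.2))
        (by fun_prop)) Computable.snd
  · exact primrec_runStart.to_comp.comp (hg.comp Computable.fst) Computable.snd
  · exact Computable.option_some.comp ((hf.pair hl).comp Computable.fst)

end Run

/-! ### Words in generators -/

/-- Words in the letters `i` (coded `(i, true)`) and `i⁻¹` (coded `(i, false)`). -/
abbrev Word (ι : Type*) := List (ι × Bool)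

/-- Instances `(x, g, L)` of the power coset membership problem: is a non-zero power of `g` in the
coset of `x` of the subgroup that `L` generates? -/
abbrev PowerCosetQuery (ι : Type*) := Word ι × Word ι × List (Word ι)

section EvalWord

variable {ι κ G : Type*} [Group G]

/-- The value of a word in the letters `s i` and their inverses. -/
def evalWord (s : ι → G) (l : Word ι) : G := FreeGroup.lift s (FreeGroup.mk l)

@[simp] theorem evalWord_nil (s : ι → G) : evalWord s [] = 1 := map_one (FreeGroup.lift s)

@[simp] theorem evalWord_append (s : ι → G) (l l' : Word ι) :
    evalWord s (l ++ l') = evalWord s l * evalWord s l' := by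
  rw [evalWord, ← FreeGroup.mul_mk, map_mul]
  rfl

theorem evalWord_cons (s : ι → G) (b : ι × Bool) (l : Word ι) :
    evalWord s (b :: l) = evalWord s [b] * evalWord s l :=
  evalWord_append s [b] l

@[simp] theorem evalWord_invRev (s : ι → G) (l : Word ι) :
    evalWord s (FreeGroup.invRev l) = (evalWord s l)⁻¹ := by
  rw [evalWord, ← FreeGroup.inv_mk, map_inv]
  rfl

theorem evalWord_singleton_true (s : ι → G) (i : ι) : evalWord s [(i, true)] = s i := by
  simp [evalWord]

theorem evalWord_eq_prod (s : ι → G) (l : Word ι) :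
    evalWord s l = (l.map fun a => if a.2 then s a.1 else (s a.1)⁻¹).prod := by
  rw [evalWord, FreeGroup.lift_mk]
  congr 2
  funext a
  cases a.2 <;> rfl

theorem map_evalWord {G' : Type*} [Group G'] (φ : G →* G') (s : ι → G) (l : Word ι) :
    φ (evalWord s l) = evalWord (φ ∘ s) l := by
  have hlift : φ.comp (FreeGroup.lift s) = FreeGroup.lift (φ ∘ s) := by
    ext i
    simp
  exact DFunLike.congr_fun hlift _

theorem evalWord_map (s : ι → G) (φ : κ → ι) (l : Word κ) :
    evalWord s (l.map fun x => (φ x.1, x.2)) = evalWord (s ∘ φ) l := by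
  rw [evalWord_eq_prod, evalWord_eq_prod, List.map_map]
  rfl

theorem evalWord_flatMap (s : ι → G) (τ : κ × Bool → Word ι) (t : κ → G)
    (hτ : ∀ x, evalWord s (τ x) = evalWord t [x]) (l : Word κ) :
    evalWord s (l.flatMap τ) = evalWord t l := by
  induction l with
  | nil => rfl
  | cons x l ih => rw [List.flatMap_cons, evalWord_append, ih, hτ, evalWord_cons t x l]

theorem exists_evalWord {s : ι → G} (hs : Subgroup.closure (Set.range s) = ⊤) (g : G) :
    ∃ l, evalWord s l = g := by
  obtain ⟨x, rfl⟩ : g ∈ (FreeGroup.lift s).range := by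
    rw [FreeGroup.range_lift_eq_closure, hs]
    trivial
  obtain ⟨l, rfl⟩ := Quot.exists_rep x
  exact ⟨l, rfl⟩

theorem evalWord_mem_closure (s : ι → G) (l : Word ι) :
    evalWord s l ∈ Subgroup.closure (Set.range s) := by
  rw [← FreeGroup.range_lift_eq_closure]
  exact ⟨_, rfl⟩

/-- The subgroup generated by the values of a list of words. -/
def wordSubgroup (s : ι → G) (L : List (Word ι)) : Subgroup G :=
  Subgroup.closure {h | ∃ l ∈ L, evalWord s l = h}

/-- The power coset membership problem for a family of elements with an arbitrary index type. -/
def PowerCoset (s : ι → G) (I : PowerCosetQuery ι) : Prop :=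
  ∃ m : ℤ, m ≠ 0 ∧ (evalWord s I.1)⁻¹ * evalWord s I.2.1 ^ m ∈ wordSubgroup s I.2.2

theorem powerCosetInstance_iff {n : ℕ} (s : Fin n → G) (I : PowerCosetQuery (Fin n)) :
    PowerCosetInstance s I ↔ PowerCoset s I := by
  have hvalue : wordValue s = evalWord s := funext fun l => (evalWord_eq_prod s l).symm
  simp only [PowerCosetInstance, PowerCoset, hvalue, mem_leftCoset_iff]
  rfl

theorem mem_wordSubgroup_iff_powerCoset {s : ι → G} {l : Word ι} {L : List (Word ι)} :
    evalWord s l ∈ wordSubgroup s L ↔ PowerCoset s (l, [], L) := by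
  simp only [PowerCoset, evalWord_nil, one_zpow, mul_one, inv_mem_iff]
  exact ⟨fun h => ⟨1, one_ne_zero, h⟩, fun ⟨_, _, h⟩ => h⟩

theorem evalWord_eq_iff_powerCoset {s : ι → G} {l l' : Word ι} :
    evalWord s l = evalWord s l' ↔ PowerCoset s (l ++ FreeGroup.invRev l', [], []) := by
  rw [← mem_wordSubgroup_iff_powerCoset, wordSubgroup]
  simp [Subgroup.mem_bot, mul_inv_eq_one]

theorem wordSubgroup_map {s : ι → G} {t : κ → G} {τ : Word κ → Word ι}
    (hτ : ∀ l, evalWord s (τ l) = evalWord t l) (L : List (Word κ)) :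
    wordSubgroup s (L.map τ) = wordSubgroup t L := by
  simp [wordSubgroup, hτ]

section Computability

variable {α : Type*} [Primcodable α] [Primcodable ι] [Primcodable κ]

theorem primrec_invRev_comp {f : α → Word ι} (hf : Primrec f) :
    Primrec fun a => FreeGroup.invRev (f a) :=
  Primrec.list_reverse.comp (Primrec.list_map hf
    ((Primrec.fst.comp Primrec.snd).pair (Primrec.not.comp (Primrec.snd.comp Primrec.snd))).to₂)

attribute [fun_prop] primrec_invRev_comp

theorem computablePred_powerCoset_of [Finite κ] {s : ι → G} (t : κ → G)
    (hs : Subgroup.closure (Set.range s) = ⊤) (h : ComputablePred (PowerCoset s)) :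
    ComputablePred (PowerCoset t) := by
  choose τ hτ using fun x => exists_evalWord hs (evalWord t [x])
  have heval := evalWord_flatMap s τ t hτ
  have hprim : Primrec fun l : Word κ => l.flatMap τ :=
    Primrec.list_flatMap Primrec.id ((Primrec.dom_finite τ).comp Primrec.snd).to₂
  have htranslate : Primrec fun I : PowerCosetQuery κ =>
      (I.1.flatMap τ, I.2.1.flatMap τ, I.2.2.map fun l => l.flatMap τ) :=
    (hprim.comp Primrec.fst).pair ((hprim.comp (by fun_prop)).pair
      (Primrec.list_map (by fun_prop) (hprim.comp Primrec.snd).to₂))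
  refine ComputablePred.computable_of_manyOneReducible ⟨_, htranslate.to_comp, fun I => ?_⟩ h
  simp only [PowerCoset, heval, wordSubgroup_map heval]

theorem rePred_evalWord_eq {s : ι → G}
    (heq : REPred fun x : Word ι × Word ι => evalWord s x.1 = evalWord s x.2)
    {f g : α → Word ι} (hf : Primrec f) (hg : Primrec g) :
    REPred fun x => evalWord s (f x) = evalWord s (g x) :=
  rePred_comp heq (hf.pair hg).to_comp

end Computability

end EvalWord


section ProductsOfWords

variable {ι α G : Type*} [Group G] {s : ι → G}

theorem evalWord_flatten_replicate (n : ℕ) (l : Word ι) :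
    evalWord s (List.replicate n l).flatten = evalWord s l ^ n := by
  induction n with
  | zero => simp
  | succ n ih => rw [List.replicate_succ, List.flatten_cons, evalWord_append, ih, pow_succ']

theorem mem_closure_iff_exists_flatten {S : Set (Word ι)} {h : G} :
    h ∈ Subgroup.closure (evalWord s '' S) ↔
      ∃ T : List (Word ι), (∀ t ∈ T, t ∈ S ∨ FreeGroup.invRev t ∈ S) ∧
        evalWord s T.flatten = h := by
  constructor
  · intro hh
    induction hh using Subgroup.closure_induction'' with
    | mem _ hx =>
      obtain ⟨l, hl, rfl⟩ := hx
      exact ⟨[l], by simp [hl], by simp⟩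
    | inv_mem _ hx =>
      obtain ⟨l, hl, rfl⟩ := hx
      exact ⟨[FreeGroup.invRev l], by simp [FreeGroup.invRev_invRev, hl], by simp⟩
    | one => exact ⟨[], by simp, by simp⟩
    | mul _ _ _ _ ihx ihy =>
      obtain ⟨T, hT, rfl⟩ := ihx
      obtain ⟨U, hU, rfl⟩ := ihy
      exact ⟨T ++ U, List.forall_mem_append.2 ⟨hT, hU⟩, by simp⟩
  · rintro ⟨T, hT, rfl⟩
    induction T with
    | nil => exact one_mem _
    | cons t T ih =>
      rw [List.forall_mem_cons] at hT
      rw [List.flatten_cons, evalWord_append]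
      refine mul_mem ?_ (ih hT.2)
      rcases hT.1 with ht | ht
      · exact Subgroup.subset_closure ⟨t, ht, rfl⟩
      · rw [← inv_mem_iff, ← evalWord_invRev]
        exact Subgroup.subset_closure ⟨_, ht, rfl⟩

theorem powerCoset_iff_exists_replicate {I : PowerCosetQuery ι} : PowerCoset s I ↔
    ∃ (n : ℕ) (k : Word ι), (k = I.2.1 ∨ k = FreeGroup.invRev I.2.1) ∧
      evalWord s (FreeGroup.invRev I.1 ++ (List.replicate (n + 1) k).flatten) ∈
        Subgroup.closure (evalWord s '' {l | l ∈ I.2.2}) := by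
  simp only [evalWord_append, evalWord_invRev, evalWord_flatten_replicate]
  constructor
  · rintro ⟨m, hm, h⟩
    obtain ⟨n, hn⟩ := Nat.exists_eq_succ_of_ne_zero (Int.natAbs_ne_zero.2 hm)
    rcases Int.natAbs_eq m with hsign | hsign <;> rw [hn] at hsign <;> subst hsign
    · exact ⟨n, I.2.1, Or.inl rfl, by rwa [← zpow_natCast]⟩
    · refine ⟨n, FreeGroup.invRev I.2.1, Or.inr rfl, ?_⟩
      rwa [evalWord_invRev, inv_pow, ← zpow_natCast, ← zpow_neg]
  · rintro ⟨n, k, rfl | rfl, h⟩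
    · exact ⟨(n + 1 : ℕ), by lia, by rwa [zpow_natCast]⟩
    · refine ⟨-(n + 1 : ℕ), by lia, ?_⟩
      rwa [zpow_neg, zpow_natCast, ← inv_pow, ← evalWord_invRev s I.2.1]

variable [Primcodable α] [Primcodable ι]

theorem primrec_flatten_replicate :
    Primrec₂ fun (n : ℕ) (l : Word ι) => (List.replicate n l).flatten := by
  refine (Primrec.list_flatMap (f := fun x : ℕ × Word ι => List.range x.1)
    (g := fun x _ => x.2) (Primrec.list_range.comp Primrec.fst)
    (Primrec.snd.comp Primrec.fst).to₂).of_eq fun x => ?_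
  simp [List.flatMap, List.map_const']

theorem rePred_mem_closure {S : α → Set (Word ι)} (hS : REPred fun x : α × Word ι => x.2 ∈ S x.1)
    (heq : REPred fun x : Word ι × Word ι => evalWord s x.1 = evalWord s x.2) {f : α → Word ι}
    (hf : Primrec f) : REPred fun a => evalWord s (f a) ∈ Subgroup.closure (evalWord s '' S a) := by
  simp only [mem_closure_iff_exists_flatten]
  refine rePred_exists (rePred_and (rePred_forall_mem
    (p := fun (x : α × List (Word ι)) t => t ∈ S x.1 ∨ FreeGroup.invRev t ∈ S x.1)
    (rePred_or (rePred_comp hS (f := fun y : (α × List (Word ι)) × Word ι => (y.1.1, y.2)) ?_)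
      (rePred_comp hS (f := fun y : (α × List (Word ι)) × Word ι =>
        (y.1.1, FreeGroup.invRev y.2)) ?_)) ?_) (rePred_evalWord_eq heq ?_ ?_)) <;> fun_prop

theorem rePred_powerCoset_of_evalWord_eq
    (heq : REPred fun x : Word ι × Word ι => evalWord s x.1 = evalWord s x.2) :
    REPred (PowerCoset s) := by
  have hpower : Primrec fun x : (PowerCosetQuery ι × ℕ) × Word ι =>
      FreeGroup.invRev x.1.1.1 ++ (List.replicate (x.1.2 + 1) x.2).flatten :=
    primrec_append_comp (by fun_prop)
      (primrec_flatten_replicate.comp (Primrec.succ.comp (by fun_prop)) Primrec.snd)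
  have hsign : REPred fun x : (PowerCosetQuery ι × ℕ) × Word ι =>
      x.2 = x.1.1.2.1 ∨ x.2 = FreeGroup.invRev x.1.1.2.1 :=
    rePred_or (rePred_eq (by fun_prop) (by fun_prop)) (rePred_eq (by fun_prop) (by fun_prop))
  have hmem := rePred_mem_closure (α := (PowerCosetQuery ι × ℕ) × Word ι)
    (S := fun x => {l | l ∈ x.1.1.2.2}) (rePred_mem (by fun_prop) (by fun_prop)) heq hpower
  refine REPred.of_eq ?_ fun I => powerCoset_iff_exists_replicate.symm
  exact rePred_exists (rePred_exists (rePred_and hsign hmem))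

theorem primrec_freeGroup_reduce [DecidableEq ι] :
    Primrec (FreeGroup.reduce : Word ι → Word ι) := by
  let step : ι × Bool → Word ι → Word ι := fun y l =>
    List.casesOn l [y] fun hd tl => if y.1 = hd.1 ∧ y.2 = !hd.2 then tl else y :: hd :: tl
  have hstep : Primrec fun z : (ι × Bool) × Word ι => step z.1 z.2 := by
    refine Primrec.list_casesOn (α := (ι × Bool) × Word ι) Primrec.snd (g := fun z => [z.1])
      (by fun_prop) (h := fun z y =>
        if z.1.1 = y.1.1 ∧ z.1.2 = !y.1.2 then y.2 else z.1 :: y.1 :: y.2) ?_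
    refine Primrec.ite ((Primrec.eq.comp (by fun_prop) (by fun_prop)).and
      (Primrec.eq.comp (by fun_prop) (Primrec.not.comp (by fun_prop)))) (by fun_prop) (by fun_prop)
  have hfold : Primrec fun l : Word ι => l.foldr step [] :=
    Primrec.list_foldr (h := fun _ y => step y.1 y.2) Primrec.id (by fun_prop)
      (hstep.comp Primrec.snd).to₂
  refine hfold.of_eq fun l => ?_
  induction l with
  | nil => rfl
  | cons y l ih => rw [List.foldr_cons, ih, FreeGroup.reduce.cons]

end ProductsOfWords

section NormalClosure

variable {ι : Type*}

theorem evalWord_freeGroup_of (l : Word ι) : evalWord FreeGroup.of l = FreeGroup.mk l :=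
  FreeGroup.lift_of_apply _

theorem conjugatesOfSet_image_mk (R : Set (Word ι)) :
    Group.conjugatesOfSet (FreeGroup.mk '' R) =
      evalWord FreeGroup.of '' {t | ∃ c, ∃ r ∈ R, t = c ++ r ++ FreeGroup.invRev c} := by
  ext y
  constructor
  · intro hy
    obtain ⟨_, ⟨r, hr, rfl⟩, hconj⟩ := Group.mem_conjugatesOfSet_iff.1 hy
    obtain ⟨⟨c⟩, rfl⟩ := isConj_iff.1 hconj
    refine ⟨_, ⟨c, r, hr, rfl⟩, ?_⟩
    simp only [evalWord_append, evalWord_invRev, evalWord_freeGroup_of]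
    rfl
  · rintro ⟨_, ⟨c, r, hr, rfl⟩, rfl⟩
    refine Group.mem_conjugatesOfSet_iff.2 ⟨_, ⟨r, hr, rfl⟩, isConj_iff.2 ⟨FreeGroup.mk c, ?_⟩⟩
    simp only [evalWord_append, evalWord_invRev, evalWord_freeGroup_of]

theorem rePred_mk_mem_normalClosure [Primcodable ι] {R : Set (Word ι)}
    (hR : REPred fun r => r ∈ R) :
    REPred fun l => FreeGroup.mk l ∈ Subgroup.normalClosure (FreeGroup.mk '' R) := by
  classical
  have heq : REPred fun x : Word ι × Word ι =>
      evalWord FreeGroup.of x.1 = evalWord FreeGroup.of x.2 := by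
    refine (rePred_eq (primrec_freeGroup_reduce.to_comp.comp Computable.fst)
      (primrec_freeGroup_reduce.to_comp.comp Computable.snd)).of_eq fun x => ?_
    rw [evalWord_freeGroup_of, evalWord_freeGroup_of]
    exact ⟨FreeGroup.reduce.exact, FreeGroup.reduce.sound⟩
  have hconj : REPred fun t : Word ι => ∃ c, ∃ r ∈ R, t = c ++ r ++ FreeGroup.invRev c := by
    refine rePred_exists (rePred_exists (rePred_and (rePred_comp hR ?_) (rePred_eq ?_ ?_))) <;>
      fun_prop
  refine (rePred_mem_closure (α := Word ι)
    (S := fun _ => {t | ∃ c, ∃ r ∈ R, t = c ++ r ++ FreeGroup.invRev c})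
    (rePred_comp hconj Computable.snd) heq Primrec.id).of_eq fun l => ?_
  rw [Subgroup.normalClosure, conjugatesOfSet_image_mk, ← evalWord_freeGroup_of]
  rfl

end NormalClosure
namespace GraphOfGroups

variable {V : Type u} [SerreGraph.{u, v} V] {A : GraphOfGroups.{u, v, w, x} V}

/-! ### Reduced paths and normal forms -/

namespace GPath

/-- The first vertex group element of a path. -/
def head : {a b : V} → A.GPath a b → A.vertexGroup a
  | _, _, nil g => g
  | _, _, cons g _ _ => g

/-- The number of edges of a path. -/
def length : {a b : V} → A.GPath a b → ℕ
  | _, _, nil _ => 0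
  | _, _, cons _ _ p => length p + 1

/-- An elementary reduction applies to the first two edges of `⟨g, e, p⟩`. -/
def Cancels {a b d : V} (e : a ⟶ b) (p : A.GPath b d) : Prop :=
  ∃ (c : A.edgeGroup e) (q : A.GPath a d), p = cons (A.ω e c) (Quiver.reverse e) q

/-- No elementary reduction applies to the path. -/
def Reduced : {a b : V} → A.GPath a b → Prop
  | _, _, nil _ => True
  | _, _, cons _ e p => ¬ Cancels e p ∧ Reduced p

@[simp] theorem head_lmul {a b : V} (g : A.vertexGroup a) (p : A.GPath a b) :
    head (lmul g p) = g * head p := by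
  cases p <;> rfl

@[simp] theorem length_lmul {a b : V} (g : A.vertexGroup a) (p : A.GPath a b) :
    length (lmul g p) = length p := by
  cases p <;> rfl

@[simp] theorem length_append {a b c : V} (p : A.GPath a b) (q : A.GPath b c) :
    length (append p q) = length p + length q := by
  induction p with
  | nil g => simp [append, length]
  | cons g e p ih => simp only [append, length, ih, Nat.add_right_comm]

@[simp] theorem reduced_lmul {a b : V} (g : A.vertexGroup a) (p : A.GPath a b) :
    Reduced (lmul g p) ↔ Reduced p := by
  cases p <;> rfl

theorem cancels_lmul {a b d : V} (e : a ⟶ b) (c : A.edgeGroup e) (p : A.GPath b d) :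
    Cancels e (lmul (A.ω e c) p) ↔ Cancels e p := by
  have cancels_of_cancels : ∀ (c : A.edgeGroup e) (p : A.GPath b d), Cancels e p →
      Cancels e (lmul (A.ω e c) p) := by
    rintro c _ ⟨c', q, rfl⟩
    exact ⟨c * c', q, by rw [lmul_cons, map_mul]⟩
  refine ⟨fun h => ?_, cancels_of_cancels c p⟩
  have := cancels_of_cancels c⁻¹ _ h
  rwa [lmul_lmul, ← map_mul, inv_mul_cancel, map_one, one_lmul] at this

/-- The chosen representative of the right coset of `g` modulo the image of the edge group, on which
normal forms of paths depend. -/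
noncomputable def cosetRep {a b : V} (e : a ⟶ b) (g : A.vertexGroup b) : A.vertexGroup b :=
  Quotient.out (Quotient.mk (QuotientGroup.rightRel (A.ω e).range) g)

theorem exists_ω_mul_cosetRep {a b : V} (e : a ⟶ b) (g : A.vertexGroup b) :
    ∃ c : A.edgeGroup e, A.ω e c * cosetRep e g = g := by
  have h : QuotientGroup.rightRel (A.ω e).range (cosetRep e g) g :=
    Quotient.exact (Quotient.out_eq (Quotient.mk (QuotientGroup.rightRel (A.ω e).range) g))
  rw [QuotientGroup.rightRel_apply] at h
  obtain ⟨c, hc⟩ := h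
  exact ⟨c, by rw [hc]; group⟩

/-- The edge group component of `g`: the element `c` with `g = ω c * cosetRep g`. -/
noncomputable def edgePart {a b : V} (e : a ⟶ b) (g : A.vertexGroup b) : A.edgeGroup e :=
  (exists_ω_mul_cosetRep e g).choose

theorem ω_edgePart_mul {a b : V} (e : a ⟶ b) (g : A.vertexGroup b) :
    A.ω e (edgePart e g) * cosetRep e g = g :=
  (exists_ω_mul_cosetRep e g).choose_spec

theorem cosetRep_ω_mul {a b : V} (e : a ⟶ b) (c : A.edgeGroup e) (g : A.vertexGroup b) :
    cosetRep e (A.ω e c * g) = cosetRep e g := by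
  refine congrArg Quotient.out (Quotient.sound ?_)
  change QuotientGroup.rightRel (A.ω e).range _ _
  rw [QuotientGroup.rightRel_apply]
  exact ⟨c⁻¹, by simp⟩

theorem edgePart_ω_mul {a b : V} (e : a ⟶ b) (c : A.edgeGroup e) (g : A.vertexGroup b) :
    edgePart e (A.ω e c * g) = c * edgePart e g := by
  apply A.ω_injective e
  rw [map_mul, ← mul_left_inj (cosetRep e g), mul_assoc, ω_edgePart_mul]
  conv_lhs => rw [← cosetRep_ω_mul e c g, ω_edgePart_mul]

theorem edgePart_cosetRep {a b : V} (e : a ⟶ b) (g : A.vertexGroup b) :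
    edgePart e (cosetRep e g) = 1 := by
  have h := edgePart_ω_mul e (edgePart e g) (cosetRep e g)
  rw [ω_edgePart_mul] at h
  exact mul_eq_left.1 h.symm

open Classical in
/-- The normal form of `⟨g, e, p⟩`, where `p` is in normal form. -/
noncomputable def normCons {a b d : V} (g : A.vertexGroup a) (e : a ⟶ b) (p : A.GPath b d) :
    A.GPath a d :=
  if h : Cancels e p then lmul (g * A.α e h.choose) h.choose_spec.choose
  else cons (g * A.α e (edgePart e (head p))) e (lmul (A.ω e (edgePart e (head p)))⁻¹ p)

/-- The normal form of a path, with respect to the chosen coset representatives. -/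
noncomputable def norm : {a b : V} → A.GPath a b → A.GPath a b
  | _, _, nil g => nil g
  | _, _, cons g e p => normCons g e (norm p)

/-- The paths in normal form. -/
def IsNormal : {a b : V} → A.GPath a b → Prop
  | _, _, nil _ => True
  | _, _, cons _ e p => edgePart e (head p) = 1 ∧ ¬ Cancels e p ∧ IsNormal p

theorem normCons_cancel {a b d : V} (g : A.vertexGroup a) (e : a ⟶ b) (c : A.edgeGroup e)
    (p : A.GPath a d) :
    normCons g e (cons (A.ω e c) (Quiver.reverse e) p) = lmul (g * A.α e c) p := by
  have h : Cancels e (cons (A.ω e c) (Quiver.reverse e) p) := ⟨c, p, rfl⟩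
  rw [normCons, dif_pos h]
  obtain ⟨hω, hp⟩ : A.ω e c = A.ω e h.choose ∧ p = h.choose_spec.choose := by
    simpa using h.choose_spec.choose_spec
  rw [← hp, ← A.ω_injective e hω]

theorem normCons_of_not_cancels {a b d : V} (g : A.vertexGroup a) (e : a ⟶ b) {p : A.GPath b d}
    (h : ¬ Cancels e p) : normCons g e p =
      cons (g * A.α e (edgePart e (head p))) e (lmul (A.ω e (edgePart e (head p)))⁻¹ p) :=
  dif_neg h

theorem lmul_normCons {a b d : V} (h g : A.vertexGroup a) (e : a ⟶ b) (p : A.GPath b d) :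
    lmul h (normCons g e p) = normCons (h * g) e p := by
  by_cases hc : Cancels e p
  · obtain ⟨c, q, rfl⟩ := hc
    rw [normCons_cancel, normCons_cancel, lmul_lmul, mul_assoc]
  · rw [normCons_of_not_cancels _ _ hc, normCons_of_not_cancels _ _ hc, lmul_cons, mul_assoc]

theorem normCons_lmul {a b d : V} (g : A.vertexGroup a) (e : a ⟶ b) (c : A.edgeGroup e)
    (p : A.GPath b d) : normCons g e (lmul (A.ω e c) p) = normCons (g * A.α e c) e p := by
  by_cases hc : Cancels e p
  · obtain ⟨c', q, rfl⟩ := hc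
    rw [normCons_cancel, lmul_cons, ← map_mul, normCons_cancel, map_mul, mul_assoc]
  · rw [normCons_of_not_cancels _ _ hc,
      normCons_of_not_cancels _ _ (mt (cancels_lmul e c p).1 hc), head_lmul, edgePart_ω_mul,
      lmul_lmul]
    simp [mul_assoc]

theorem isNormal_lmul {a b : V} (g : A.vertexGroup a) (p : A.GPath a b) :
    IsNormal (lmul g p) ↔ IsNormal p := by
  cases p <;> rfl

theorem IsNormal.normCons {a b d : V} (g : A.vertexGroup a) (e : a ⟶ b) {p : A.GPath b d}
    (hp : IsNormal p) : IsNormal (normCons g e p) := by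
  by_cases hc : Cancels e p
  · obtain ⟨c, q, rfl⟩ := hc
    rw [normCons_cancel, isNormal_lmul]
    exact hp.2.2
  · rw [normCons_of_not_cancels _ _ hc]
    refine ⟨?_, ?_, ?_⟩
    · rw [head_lmul, inv_mul_eq_of_eq_mul (ω_edgePart_mul e (head p)).symm]
      exact edgePart_cosetRep e _
    · rwa [← map_inv, cancels_lmul]
    · rwa [isNormal_lmul]

theorem isNormal_norm {a b : V} (p : A.GPath a b) : IsNormal (norm p) := by
  induction p with
  | nil _ => trivial
  | cons g e p ih => exact ih.normCons g e

theorem normCons_eq_cons {a b d : V} (g : A.vertexGroup a) (e : a ⟶ b) {p : A.GPath b d}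
    (h₁ : edgePart e (head p) = 1) (h₂ : ¬ Cancels e p) : normCons g e p = cons g e p := by
  rw [normCons_of_not_cancels _ _ h₂, h₁]
  simp [one_lmul]

theorem normCons_normCons_reverse {a b d : V} (e : a ⟶ b) {p : A.GPath a d} (hp : IsNormal p) :
    normCons 1 e (normCons 1 (Quiver.reverse e) p) = p := by
  by_cases hc : Cancels (Quiver.reverse e) p
  · obtain ⟨c, q, rfl⟩ := hc
    obtain ⟨c, rfl⟩ := (A.rev e).surjective c
    rw [normCons_cancel, one_mul, A.α_rev, normCons_lmul, one_mul, A.ω_rev]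
    obtain ⟨h₁, h₂, -⟩ := hp
    generalize hr : Quiver.reverse (Quiver.reverse e) = e' at h₁ h₂ ⊢
    rw [Quiver.reverse_reverse] at hr
    subst hr
    exact normCons_eq_cons _ _ h₁ h₂
  · rw [normCons_of_not_cancels _ _ hc]
    obtain ⟨c, hc'⟩ := (A.rev e).surjective (edgePart (Quiver.reverse e) (head p))
    rw [← hc', one_mul, A.α_rev, normCons_cancel, one_mul, A.ω_rev, lmul_lmul, mul_inv_cancel,
      one_lmul]

theorem norm_lmul {a b : V} (g : A.vertexGroup a) (p : A.GPath a b) :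
    norm (lmul g p) = lmul g (norm p) := by
  cases p with
  | nil h => rfl
  | cons h e p => exact (lmul_normCons g h e (norm p)).symm

theorem Red.norm_eq {a b : V} {p q : A.GPath a b} (h : Red p q) : norm p = norm q := by
  induction h with
  | head g e c p =>
    have h := normCons_normCons_reverse e (isNormal_norm p)
    rw [norm_lmul]
    conv_rhs => rw [← h, lmul_normCons, mul_one, ← normCons_lmul, lmul_normCons, mul_one]
    rfl
  | tail g e _ ih => exact congrArg (normCons g e) ih

theorem Equiv.norm_eq {a b : V} {p q : A.GPath a b} (h : Equiv p q) : norm p = norm q := by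
  induction h with
  | rel p q h => exact h.norm_eq
  | refl p => rfl
  | symm p q _ ih => exact ih.symm
  | trans p q r _ _ ih₁ ih₂ => exact ih₁.trans ih₂

theorem not_cancels_norm {a b d : V} (e : a ⟶ b) {p : A.GPath b d} (hp : Reduced p)
    (h : ¬ Cancels e p) : ¬ Cancels e (norm p) := by
  induction p generalizing a with
  | nil g => exact h
  | cons g f p ih =>
    rintro ⟨c, q, hq⟩
    rw [norm, normCons_of_not_cancels _ _ (ih f hp.2 hp.1)] at hq
    simp only [cons.injEq] at hq
    obtain ⟨rfl, h₁, h₂, -⟩ := hq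
    obtain rfl := eq_of_heq h₂
    generalize edgePart (Quiver.reverse e) (head (norm p)) = c' at h₁
    obtain ⟨c', rfl⟩ := (A.rev e).surjective c'
    rw [A.α_rev, ← eq_mul_inv_iff_mul_eq, ← map_inv, ← map_mul] at h₁
    exact h ⟨_, _, by rw [h₁]⟩

theorem cancels_of_cancels_append {a b c d : V} {e : a ⟶ b} {p : A.GPath b c} {q : A.GPath c d}
    (hp : 0 < p.length) (h : Cancels e (append p q)) : Cancels e p := by
  cases p with
  | nil g => simp [length] at hp
  | cons g f p =>
    obtain ⟨s, r, h⟩ := h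
    simp only [append, cons.injEq] at h
    obtain ⟨rfl, rfl, hf, -⟩ := h
    obtain rfl := eq_of_heq hf
    exact ⟨s, p, rfl⟩

theorem Reduced.append_append {a b c d : V} {p : A.GPath a b} {q : A.GPath b c} {r : A.GPath c d}
    (hq : 0 < q.length) (hpq : Reduced (append p q)) (hqr : Reduced (append q r)) :
    Reduced (append p (append q r)) := by
  induction p with
  | nil g => simpa [append] using hqr
  | cons g e p ih =>
    refine ⟨fun h => hpq.1 ?_, ih hq hpq.2 hqr⟩
    rw [← append_assoc] at h
    exact cancels_of_cancels_append (by rw [length_append]; omega) h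

theorem Red.length_lt {a b : V} {p q : A.GPath a b} (h : Red p q) : q.length < p.length := by
  induction h with
  | head g e c p => simp [length]
  | tail g e _ ih => simpa [length] using ih

theorem exists_red_of_not_reduced {a b : V} {p : A.GPath a b} (h : ¬ Reduced p) :
    ∃ q, Red p q := by
  induction p with
  | nil g => exact (h trivial).elim
  | cons g e p ih =>
    by_cases hc : Cancels e p
    · obtain ⟨c, q, rfl⟩ := hc
      exact ⟨_, Red.head g e c q⟩
    · obtain ⟨q, hq⟩ := ih fun h' => h ⟨hc, h'⟩
      exact ⟨_, Red.tail g e hq⟩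

/-! ### Cyclically reduced loops -/

/-- The power `c ^ (n + 1)` of a loop `c`. Only positive powers are defined, so that powers of a
loop with edges have edges. -/
def powSucc {a : V} (c : A.GPath a a) : ℕ → A.GPath a a
  | 0 => c
  | n + 1 => append c (powSucc c n)

/-- A loop is cyclically reduced if it is reduced and remains reduced when it is traversed twice. In
particular, this holds for loops without edges. -/
def CyclicallyReduced {a : V} (c : A.GPath a a) : Prop :=
  Reduced c ∧ Reduced (append c c)

/-- Two loops, possibly with different base points, are conjugate in the path groupoid. -/
def Conjugate {a b : V} (p : A.GPath a a) (c : A.GPath b b) : Prop :=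
  ∃ y : A.GPath a b, Equiv (append p y) (append y c)

theorem CyclicallyReduced.reduced_powSucc {a : V} {c : A.GPath a a} (h : CyclicallyReduced c)
    (n : ℕ) : Reduced (powSucc c n) := by
  obtain ⟨hc, hcc⟩ := h
  cases c with
  | nil g =>
    cases n with
    | zero => exact hc
    | succ n =>
      induction n with
      | zero => exact hcc
      | succ n ih => exact (reduced_lmul g _).2 ih
  | cons g e c =>
    have hpow : ∀ n, Reduced (powSucc (cons g e c) n) ∧
        Reduced (append (cons g e c) (powSucc (cons g e c) n)) := by
      intro n
      induction n with
      | zero => exact ⟨hc, hcc⟩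
      | succ n ih => exact ⟨ih.2, hcc.append_append (Nat.succ_pos _) ih.2⟩
    exact (hpow n).1

theorem Equiv.conjugate {a : V} {p q : A.GPath a a} (h : Equiv p q) : Conjugate p q :=
  ⟨nil 1, by rwa [append_one, GPath.append, one_lmul]⟩

theorem Conjugate.trans {a b d : V} {p : A.GPath a a} {q : A.GPath b b} {r : A.GPath d d}
    (hpq : Conjugate p q) (hqr : Conjugate q r) : Conjugate p r := by
  obtain ⟨y, hy⟩ := hpq
  obtain ⟨z, hz⟩ := hqr
  refine ⟨append y z, ?_⟩
  have hy' := hy.append (Equiv.refl z)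
  have hz' := (Equiv.refl y).append hz
  rw [append_assoc, append_assoc] at hy'
  rw [append_assoc]
  exact hy'.trans hz'

theorem conjugate_append_comm {a b : V} (p : A.GPath a b) (q : A.GPath b a) :
    Conjugate (append p q) (append q p) :=
  ⟨p, by rw [append_assoc]; exact Equiv.refl _⟩

theorem cyclicallyReduced_cons {a b : V} {g : A.vertexGroup a} {e : a ⟶ b} {p : A.GPath b a}
    (h : Reduced (cons g e p)) (hrot : Reduced (append p (cons g e (nil 1)))) :
    CyclicallyReduced (cons g e p) := by
  refine ⟨h, ?_⟩
  cases p with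
  | nil k =>
    refine ⟨?_, ?_, trivial⟩
    · rintro ⟨s, q, h⟩
      simp only [append, lmul, cons.injEq] at h
      exact SerreGraph.reverse_ne e (eq_of_heq h.2.2.1).symm
    · rintro ⟨s, q, h⟩
      cases h
  | cons k f p =>
    have hsplit : cons g e (cons k f p) = append (cons g e (nil 1)) (cons k f p) := by
      simp [append, one_lmul]
    rw [hsplit] at h ⊢
    rw [append_assoc]
    exact h.append_append (Nat.succ_pos _) (hrot.append_append (Nat.succ_pos _) h)

theorem exists_conjugate_cyclicallyReduced {v₀ : V} (p : A.GPath v₀ v₀) :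
    ∃ (a : V) (c : A.GPath a a), Conjugate p c ∧ CyclicallyReduced c := by
  induction hn : p.length using Nat.strong_induction_on generalizing v₀ with
  | _ n ih =>
    have of_not_reduced : ∀ {b : V} (q : A.GPath b b), Conjugate p q → q.length = p.length →
        ¬ Reduced q → ∃ (a : V) (c : A.GPath a a), Conjugate p c ∧ CyclicallyReduced c := by
      intro b q hpq hlength hq
      obtain ⟨r, hr⟩ := exists_red_of_not_reduced hq
      obtain ⟨a, c, hrc, hc⟩ := ih r.length (by have := hr.length_lt; omega) r rfl
      exact ⟨a, c, hpq.trans (hr.equiv.conjugate.trans hrc), hc⟩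
    by_cases hp : Reduced p
    · cases p with
      | nil g => exact ⟨v₀, nil g, (Equiv.refl _).conjugate, trivial, trivial⟩
      | cons g e p =>
        by_cases hrot : Reduced (append p (cons g e (nil 1)))
        · exact ⟨v₀, _, (Equiv.refl _).conjugate, cyclicallyReduced_cons hp hrot⟩
        · refine of_not_reduced _ ?_ (by simp [length]) hrot
          simpa [append, one_lmul] using conjugate_append_comm (cons g e (nil 1)) p
    · exact of_not_reduced p (Equiv.refl p).conjugate rfl hp

end GPath

/-! ### Partial actions of a graph of groups -/

variable (A) in
/-- A partial action of a graph of groups: sets with actions of the vertex groups and partial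
bijections between them, one for each edge, that are equivariant under the edge groups. Paths act
on it only where all the partial bijections along the way are defined, so that a finite piece of a
coset space of the fundamental group generates one. -/
structure PartialAction where
  /-- The set for a vertex. -/
  Pt : V → Type*
  [inst : ∀ a, MulAction (A.vertexGroup a) (Pt a)]
  /-- The graph of the partial bijection for an edge. -/
  Step : ∀ {a b : V}, (a ⟶ b) → Pt a → Pt b → Prop
  step_unique : ∀ {a b : V} {e : a ⟶ b} {x : Pt a} {y z : Pt b}, Step e x y → Step e x z → y = z
  step_smul : ∀ {a b : V} {e : a ⟶ b} {x : Pt a} {y : Pt b} (c : A.edgeGroup e), Step e x y →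
    Step e (A.α e c • x) (A.ω e c • y)
  step_reverse : ∀ {a b : V} {e : a ⟶ b} {x : Pt a} {y : Pt b}, Step e x y →
    Step (Quiver.reverse e) y x

namespace PartialAction

open GPath

instance instMulActionPt (P : A.PartialAction) (a : V) : MulAction (A.vertexGroup a) (P.Pt a) :=
  P.inst a

variable (P : A.PartialAction)

/-- `P.Moves p x y`: the path `p` takes `x` to `y`. Paths act from the right while the vertex groups
act from the left, whence the inverses. -/
def Moves : {a b : V} → A.GPath a b → P.Pt a → P.Pt b → Prop
  | _, _, nil g, x, y => g⁻¹ • x = y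
  | _, _, cons g e p, x, y => ∃ z, P.Step e (g⁻¹ • x) z ∧ Moves p z y

variable {P}

theorem moves_lmul {a b : V} {g : A.vertexGroup a} {p : A.GPath a b} {x : P.Pt a} {y : P.Pt b} :
    P.Moves (lmul g p) x y ↔ P.Moves p (g⁻¹ • x) y := by
  cases p <;> simp [lmul, Moves, mul_smul]

theorem moves_append {a b c : V} {p : A.GPath a b} {q : A.GPath b c} {x : P.Pt a} {y : P.Pt c} :
    P.Moves (append p q) x y ↔ ∃ z, P.Moves p x z ∧ P.Moves q z y := by
  induction p with
  | nil g => simp [append, moves_lmul, Moves]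
  | cons g e p ih =>
    simp only [append, Moves, ih]
    exact ⟨fun ⟨z, h, t, h', h''⟩ => ⟨t, ⟨z, h, h'⟩, h''⟩,
      fun ⟨t, ⟨z, h, h'⟩, h''⟩ => ⟨z, h, t, h', h''⟩⟩

theorem Moves.inv {a b : V} {p : A.GPath a b} {x : P.Pt a} {y : P.Pt b} (h : P.Moves p x y) :
    P.Moves (GPath.inv p) y x := by
  induction p with
  | nil g =>
    obtain rfl := h
    simp [GPath.inv, Moves]
  | cons g e p ih =>
    obtain ⟨z, h₁, h₂⟩ := h
    rw [GPath.inv, moves_append]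
    refine ⟨z, ih h₂, g⁻¹ • x, ?_, ?_⟩
    · simpa using P.step_reverse h₁
    · simp [Moves]

theorem Moves.red {a b : V} {p q : A.GPath a b} (hr : Red p q) {x : P.Pt a} {y : P.Pt b}
    (h : P.Moves p x y) : P.Moves q x y := by
  induction hr with
  | head g e c p =>
    obtain ⟨z, h₁, t, h₂, h₃⟩ := h
    have h₄ := P.step_reverse (P.step_smul c⁻¹ h₁)
    rw [map_inv, map_inv] at h₄
    obtain rfl := P.step_unique h₂ h₄
    rw [moves_lmul]
    simpa [mul_smul] using h₃
  | tail g e _ ih =>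
    obtain ⟨z, h₁, h₂⟩ := h
    exact ⟨z, h₁, ih h₂⟩

theorem moves_twist {a b d : V} (g : A.vertexGroup a) (e : a ⟶ b) (c : A.edgeGroup e)
    {p : A.GPath b d} {x : P.Pt a} {y : P.Pt d} :
    P.Moves (cons (g * A.α e c) e (lmul (A.ω e c)⁻¹ p)) x y ↔ P.Moves (cons g e p) x y := by
  simp only [Moves, moves_lmul, inv_inv]
  constructor
  · rintro ⟨z, h₁, h₂⟩
    refine ⟨_, ?_, h₂⟩
    simpa [mul_smul] using P.step_smul c h₁
  · rintro ⟨z, h₁, h₂⟩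
    refine ⟨(A.ω e c)⁻¹ • z, ?_, by simpa using h₂⟩
    simpa [mul_smul] using P.step_smul c⁻¹ h₁

theorem Moves.normCons {a b d : V} {g : A.vertexGroup a} {e : a ⟶ b} {p : A.GPath b d} {x : P.Pt a}
    {y : P.Pt d} (h : P.Moves (cons g e p) x y) : P.Moves (normCons g e p) x y := by
  by_cases hc : Cancels e p
  · obtain ⟨c, q, rfl⟩ := hc
    rw [normCons_cancel]
    exact h.red (Red.head g e c q)
  · rw [normCons_of_not_cancels _ _ hc]
    exact (moves_twist g e _).2 h

theorem Moves.norm {a b : V} {p : A.GPath a b} {x : P.Pt a} {y : P.Pt b} (h : P.Moves p x y) :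
    P.Moves (norm p) x y := by
  induction p with
  | nil g => exact h
  | cons g e p ih =>
    obtain ⟨z, h₁, h₂⟩ := h
    exact Moves.normCons ⟨z, h₁, ih h₂⟩

theorem Moves.of_norm {a b : V} {p : A.GPath a b} (hp : Reduced p) {x : P.Pt a} {y : P.Pt b}
    (h : P.Moves (GPath.norm p) x y) : P.Moves p x y := by
  induction p with
  | nil g => exact h
  | cons g e p ih =>
    rw [GPath.norm, normCons_of_not_cancels _ _ (not_cancels_norm e hp.2 hp.1), moves_twist] at h
    obtain ⟨z, h₁, h₂⟩ := h
    exact ⟨z, h₁, ih hp.2 h₂⟩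

theorem Moves.of_equiv {a b : V} {p q : A.GPath a b} (hp : Reduced p) (hpq : Equiv p q)
    {x : P.Pt a} {y : P.Pt b} (h : P.Moves q x y) : P.Moves p x y :=
  Moves.of_norm hp (hpq.norm_eq ▸ h.norm)

end PartialAction

/-! ### The path groupoid acting on the fundamental group -/

section Transport

open GPath

/-- The element of the fundamental group that a loop represents. -/
def loopClass {v₀ : V} (p : A.GPath v₀ v₀) : A.FundamentalGroup v₀ := Quotient.mk _ p

theorem loopClass_append {v₀ : V} (p q : A.GPath v₀ v₀) :
    loopClass (append p q) = loopClass p * loopClass q := rfl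

theorem loopClass_inv {v₀ : V} (p : A.GPath v₀ v₀) :
    loopClass (GPath.inv p) = (loopClass p)⁻¹ := rfl

theorem loopClass_eq_iff {v₀ : V} {p q : A.GPath v₀ v₀} :
    loopClass p = loopClass q ↔ GPath.Equiv p q :=
  ⟨fun h => Quotient.exact h, fun h => Quotient.sound h⟩

open Classical in
/-- A functor from the path groupoid to the fundamental group that is the identity on loops. It
joins the ends of a path to `v₀` by fixed paths, if they lie in the component of `v₀`. -/
noncomputable def transport (v₀ : V) {a b : V} (p : A.GPath a b) : A.FundamentalGroup v₀ :=
  if h : Nonempty (A.GPath v₀ a) then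
    (loopClass (Nonempty.some ⟨nil 1⟩))⁻¹ *
      loopClass (append h.some (append p (GPath.inv
        (Nonempty.some (⟨append h.some p⟩ : Nonempty (A.GPath v₀ b)))))) *
      loopClass (Nonempty.some ⟨nil 1⟩)
  else 1

theorem transport_append (v₀ : V) {a b c : V} (p : A.GPath a b) (q : A.GPath b c) :
    transport v₀ (append p q) = transport v₀ p * transport v₀ q := by
  by_cases h : Nonempty (A.GPath v₀ a)
  · have h' : Nonempty (A.GPath v₀ b) := ⟨append h.some p⟩
    rw [transport, transport, transport, dif_pos h, dif_pos h, dif_pos h']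
    have loopClass_through : ∀ (γ : A.GPath v₀ a) (δ : A.GPath v₀ b) (ε : A.GPath v₀ c),
        loopClass (append γ (append (append p q) (GPath.inv ε))) =
        loopClass (append γ (append p (GPath.inv δ))) *
          loopClass (append δ (append q (GPath.inv ε))) := by
      intro γ δ ε
      rw [← loopClass_append, loopClass_eq_iff]
      have hδ := (inv_append δ).append (GPath.Equiv.refl (append q (GPath.inv ε)))
      have hγδ := (GPath.Equiv.refl (append γ p)).append hδ
      simpa [append_assoc, append, one_lmul] using hγδ.symm
    rw [loopClass_through _ h'.some]
    group
  · have h' : ¬ Nonempty (A.GPath v₀ b) := fun ⟨r⟩ => h ⟨append r (GPath.inv p)⟩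
    rw [transport, transport, transport, dif_neg h, dif_neg h, dif_neg h', one_mul]

theorem transport_congr (v₀ : V) {a b : V} {p q : A.GPath a b} (hpq : GPath.Equiv p q) :
    transport v₀ p = transport v₀ q := by
  by_cases h : Nonempty (A.GPath v₀ a)
  · rw [transport, transport, dif_pos h, dif_pos h]
    congr 2
    rw [loopClass_eq_iff]
    exact (GPath.Equiv.refl _).append (hpq.append (GPath.Equiv.refl _))
  · rw [transport, transport, dif_neg h, dif_neg h]

theorem transport_loop {v₀ : V} (p : A.GPath v₀ v₀) : transport v₀ p = loopClass p := by
  rw [transport, dif_pos (⟨nil 1⟩ : Nonempty (A.GPath v₀ v₀)), loopClass_append, loopClass_append,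
    loopClass_inv]
  group

theorem transport_one (v₀ a : V) : transport v₀ (nil 1 : A.GPath a a) = 1 := by
  have h := transport_append v₀ (nil 1 : A.GPath a a) (nil 1)
  rw [append_one] at h
  exact mul_eq_left.1 h.symm

variable (A) in
/-- The homomorphism from the vertex group at `a` to the fundamental group. -/
noncomputable def vertexHom (v₀ a : V) : A.vertexGroup a →* A.FundamentalGroup v₀ where
  toFun g := transport v₀ (nil g)
  map_one' := transport_one v₀ a
  map_mul' g h := transport_append v₀ (nil g) (nil h)

variable (A) in
/-- The stable letter of an edge, as an element of the fundamental group. -/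
noncomputable def edgeElement (v₀ : V) {a b : V} (e : a ⟶ b) : A.FundamentalGroup v₀ :=
  transport v₀ (cons (1 : A.vertexGroup a) e (nil 1))

theorem vertexHom_apply (v₀ : V) {a : V} (g : A.vertexGroup a) :
    A.vertexHom v₀ a g = transport v₀ (nil g) := rfl

theorem transport_lmul (v₀ : V) {a b : V} (g : A.vertexGroup a) (p : A.GPath a b) :
    transport v₀ (lmul g p) = A.vertexHom v₀ a g * transport v₀ p :=
  transport_append v₀ (nil g) p

theorem transport_cons_one (v₀ : V) {a b c : V} (e : a ⟶ b) (p : A.GPath b c) :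
    transport v₀ (cons 1 e p) = A.edgeElement v₀ e * transport v₀ p := by
  rw [edgeElement, ← transport_append]
  simp [append, one_lmul]

theorem edgeElement_mul_vertexHom_mul (v₀ : V) {a b : V} (e : a ⟶ b) (c : A.edgeGroup e) :
    A.edgeElement v₀ e * A.vertexHom v₀ b (A.ω e c) * A.edgeElement v₀ (Quiver.reverse e) =
      A.vertexHom v₀ a (A.α e c) := by
  have h := transport_congr v₀ (Red.head 1 e c (nil (1 : A.vertexGroup a))).equiv
  have hlmul : cons (A.ω e c) (Quiver.reverse e) (nil (1 : A.vertexGroup a)) =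
      lmul (A.ω e c) (cons 1 (Quiver.reverse e) (nil 1)) := by simp [lmul]
  rw [transport_cons_one, hlmul, transport_lmul] at h
  rw [mul_assoc, vertexHom_apply v₀ (A.α e c)]
  simpa [edgeElement, lmul] using h

theorem edgeElement_mul_reverse (v₀ : V) {a b : V} (e : a ⟶ b) :
    A.edgeElement v₀ e * A.edgeElement v₀ (Quiver.reverse e) = 1 := by
  simpa using edgeElement_mul_vertexHom_mul v₀ e (1 : A.edgeGroup e)

theorem edgeElement_reverse (v₀ : V) {a b : V} (e : a ⟶ b) :
    A.edgeElement v₀ (Quiver.reverse e) = (A.edgeElement v₀ e)⁻¹ :=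
  (inv_eq_of_mul_eq_one_right (edgeElement_mul_reverse v₀ e)).symm

theorem vertexHom_mul_edgeElement (v₀ : V) {a b : V} (e : a ⟶ b) (c : A.edgeGroup e) :
    A.vertexHom v₀ a (A.α e c) * A.edgeElement v₀ e =
      A.edgeElement v₀ e * A.vertexHom v₀ b (A.ω e c) := by
  rw [← edgeElement_mul_vertexHom_mul, edgeElement_reverse, inv_mul_cancel_right]

theorem transport_inv (v₀ : V) {a b : V} (p : A.GPath a b) :
    transport v₀ (GPath.inv p) = (transport v₀ p)⁻¹ := by
  rw [eq_inv_iff_mul_eq_one, ← transport_append, transport_congr v₀ (inv_append p), transport_one]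

theorem transport_powSucc (v₀ : V) {a : V} (c : A.GPath a a) (n : ℕ) :
    transport v₀ (powSucc c n) = transport v₀ c ^ (n + 1) := by
  induction n with
  | zero => simp [powSucc]
  | succ n ih => rw [powSucc, transport_append, ih, ← pow_succ']

theorem equiv_of_transport_eq {v₀ a b : V} (y : A.GPath v₀ a) {p q : A.GPath a b}
    (h : transport v₀ p = transport v₀ q) : GPath.Equiv p q := by
  have hloop : loopClass (append y (append p (GPath.inv (append y q)))) = loopClass (nil 1) := by
    simp only [← transport_loop, transport_append, transport_inv, transport_one, h]
    group
  have hy := ((GPath.Equiv.refl (GPath.inv y)).append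
    (loopClass_eq_iff.1 hloop)).append (GPath.Equiv.refl (append y q))
  have hcancel := (inv_append y).append ((GPath.Equiv.refl p).append (inv_append (append y q)))
  have hcancel' := (inv_append y).append (GPath.Equiv.refl q)
  simp only [append_assoc, append_one] at hy hcancel
  simp only [append, one_lmul, append_assoc] at hy hcancel hcancel'
  exact hcancel.symm.trans (hy.trans hcancel')

namespace PartialAction

variable {P : A.PartialAction}

theorem Moves.of_transport_eq {v₀ a b : V} (y : A.GPath v₀ a) {p q : A.GPath a b} (hp : Reduced p)
    (h : transport v₀ p = transport v₀ q) {X : P.Pt a} {Y : P.Pt b} (hq : P.Moves q X Y) :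
    P.Moves p X Y :=
  hq.of_equiv hp (equiv_of_transport_eq y h)

theorem exists_moves_of_mem_closure {v₀ : V} {S : Set (A.FundamentalGroup v₀)} {X : P.Pt v₀}
    (hS : ∀ h ∈ S, ∃ η : A.GPath v₀ v₀, loopClass η = h ∧ P.Moves η X X)
    {h : A.FundamentalGroup v₀} (hh : h ∈ Subgroup.closure S) :
    ∃ η : A.GPath v₀ v₀, loopClass η = h ∧ P.Moves η X X := by
  induction hh using Subgroup.closure_induction with
  | mem h hh => exact hS h hh
  | one => exact ⟨nil 1, rfl, by simp [Moves]⟩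
  | mul g h _ _ ihg ihh =>
    obtain ⟨η, rfl, hη⟩ := ihg
    obtain ⟨θ, rfl, hθ⟩ := ihh
    exact ⟨append η θ, rfl, moves_append.2 ⟨X, hη, hθ⟩⟩
  | inv h _ ih =>
    obtain ⟨η, rfl, hη⟩ := ih
    exact ⟨GPath.inv η, rfl, hη.inv⟩

end PartialAction

end Transport


/-! ### Words for paths -/

variable (V) in
/-- Edges, bundled with their endpoints. -/
abbrev TotalEdge := Σ a b : V, (a ⟶ b)

variable (V) in
/-- The letters for paths: `Sum.inl (a, k)` is the `k`-th generator of the vertex group at `a`. -/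
abbrev Letter (K : Type*) := (V × K) ⊕ TotalEdge V

/-- The reverse of a bundled edge. -/
def TotalEdge.rev (e : TotalEdge V) : TotalEdge V := ⟨e.2.1, e.1, Quiver.reverse e.2.2⟩

variable (A) in
/-- Elements of edge groups, bundled with their edges. -/
abbrev EdgeElement := Σ e : TotalEdge V, A.edgeGroup e.2.2

variable (A) in
/-- Generators of the vertex groups with a common index type, and words in them for the images of
the elements of the edge groups. -/
structure Coding (K : Type*) where
  gen : ∀ a, K → A.vertexGroup a
  closure_gen : ∀ a, Subgroup.closure (Set.range (gen a)) = ⊤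
  αWord : A.EdgeElement → Word K
  ωWord : A.EdgeElement → Word K
  evalWord_αWord : ∀ c, evalWord (gen c.1.1) (αWord c) = A.α c.1.2.2 c.2
  evalWord_ωWord : ∀ c, evalWord (gen c.1.2.1) (ωWord c) = A.ω c.1.2.2 c.2

theorem exists_coding {K : Type*} (gen : ∀ a, K → A.vertexGroup a)
    (h : ∀ a, Subgroup.closure (Set.range (gen a)) = ⊤) : ∃ C : A.Coding K, C.gen = gen := by
  choose aw haw using fun c : A.EdgeElement => exists_evalWord (h c.1.1) (A.α c.1.2.2 c.2)
  choose ow how using fun c : A.EdgeElement => exists_evalWord (h c.1.2.1) (A.ω c.1.2.2 c.2)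
  exact ⟨⟨gen, h, aw, ow, haw, how⟩, rfl⟩

namespace Coding

open GPath

variable {K : Type*} (C : A.Coding K)

/-- The element of the fundamental group for a letter. Letters outside the component of `v₀` have
the value `1`. -/
noncomputable def letter (v₀ : V) : Letter V K → A.FundamentalGroup v₀
  | Sum.inl (a, k) => A.vertexHom v₀ a (C.gen a k)
  | Sum.inr e => A.edgeElement v₀ e.2.2

/-- `C.PathWord p f`: the word `f` spells the path `p`. Edges occur in `f` with exponent `1`
only. -/
inductive PathWord : {a b : V} → A.GPath a b → Word (Letter V K) → Prop
  | nil (a : V) : PathWord (GPath.nil (1 : A.vertexGroup a)) []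
  | vertex {a b : V} (k : K) (β : Bool) {p : A.GPath a b} {f : Word (Letter V K)} :
      PathWord p f →
        PathWord (lmul (evalWord (C.gen a) [(k, β)]) p) ((Sum.inl (a, k), β) :: f)
  | edge {a b c : V} (e : a ⟶ b) {p : A.GPath b c} {f : Word (Letter V K)} :
      PathWord p f → PathWord (GPath.cons 1 e p) ((Sum.inr ⟨a, b, e⟩, true) :: f)

variable {C} in
theorem PathWord.append {a b c : V} {p : A.GPath a b} {q : A.GPath b c}
    {f g : Word (Letter V K)} (hp : C.PathWord p f) (hq : C.PathWord q g) :
    C.PathWord (GPath.append p q) (f ++ g) := by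
  induction hp with
  | nil a => simpa [GPath.append, one_lmul] using hq
  | vertex k β _ ih => rw [lmul_append]; exact (ih hq).vertex k β
  | edge e _ ih => exact (ih hq).edge e

/-- A word in the generators of the vertex group at `a`, as a word for a path without edges. -/
def vertexWord (a : V) (w : Word K) : Word (Letter V K) :=
  w.map fun x => (Sum.inl (a, x.1), x.2)

theorem pathWord_vertexWord (a : V) (w : Word K) :
    C.PathWord (GPath.nil (evalWord (C.gen a) w)) (vertexWord a w) := by
  induction w with
  | nil => simpa [vertexWord] using PathWord.nil (C := C) a
  | cons b w ih => rw [evalWord_cons]; exact ih.vertex b.1 b.2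

theorem exists_pathWord {a b : V} (p : A.GPath a b) : ∃ f, C.PathWord p f := by
  induction p with
  | nil g =>
    obtain ⟨w, rfl⟩ := exists_evalWord (C.closure_gen _) g
    exact ⟨_, C.pathWord_vertexWord _ w⟩
  | @cons a b _ g e p ih =>
    obtain ⟨f, hf⟩ := ih
    obtain ⟨w, rfl⟩ := exists_evalWord (C.closure_gen _) g
    refine ⟨vertexWord a w ++ (Sum.inr ⟨a, b, e⟩, true) :: f, ?_⟩
    simpa [GPath.append, lmul] using (C.pathWord_vertexWord a w).append (hf.edge e)

variable {C} in
theorem PathWord.evalWord_eq {a b : V} {p : A.GPath a b} {f : Word (Letter V K)}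
    (h : C.PathWord p f) (v₀ : V) : evalWord (C.letter v₀) f = transport v₀ p := by
  induction h with
  | nil a => rw [transport_one, evalWord_nil]
  | @vertex a _ k β _ _ _ ih =>
    rw [evalWord_cons, ih, transport_lmul, map_evalWord]
    rfl
  | edge e _ ih =>
    rw [evalWord_cons, ih, transport_cons_one, evalWord_singleton_true]
    rfl

/-! ### Points -/

variable (V K) in
/-- Labels of orbits of a vertex group. The list consists of generators of the stabilizer of the
base point of the orbit; the word distinguishes orbits with equal stabilizers. -/
abbrev Label := Word (Letter V K) × List (Word K)

variable (V K) in
/-- Names of points: the label of an orbit, and a word for the element that takes the base point of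
the orbit to the point. -/
abbrev Point := Label V K × Word K

/-- The action of a word on points from the right. -/
def shift (x : Point V K) (w : Word K) : Point V K := (x.1, x.2 ++ w)

/-- Two names denote the same point over the vertex `a`. -/
def SamePoint (a : V) (x y : Point V K) : Prop :=
  x.1 = y.1 ∧
    evalWord (C.gen a) x.2 * (evalWord (C.gen a) y.2)⁻¹ ∈ wordSubgroup (C.gen a) x.1.2

/-- The point over the vertex `a` that is named `x`. Right cosets are turned into left cosets by
inversion, so that Mathlib's left action on quotients applies. -/
def toPt (a : V) (x : Point V K) :
    Σ o : Label V K, A.vertexGroup a ⧸ wordSubgroup (C.gen a) o.2 :=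
  ⟨x.1, ((evalWord (C.gen a) x.2)⁻¹ : A.vertexGroup a)⟩

theorem inv_smul_toPt_eq_iff (a : V) (g : A.vertexGroup a) (x y : Point V K) :
    g⁻¹ • C.toPt a x = C.toPt a y ↔ x.1 = y.1 ∧
      evalWord (C.gen a) x.2 * g * (evalWord (C.gen a) y.2)⁻¹ ∈
        wordSubgroup (C.gen a) x.1.2 := by
  obtain ⟨o, x⟩ := x
  obtain ⟨o', y⟩ := y
  constructor
  · intro h
    obtain ⟨rfl, hcoset⟩ := Sigma.mk.inj_iff.1 h
    exact ⟨rfl, by simpa [mul_assoc, toPt] using QuotientGroup.eq.1 (eq_of_heq hcoset)⟩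
  · rintro ⟨rfl, hmem⟩
    refine Sigma.mk.inj_iff.2 ⟨rfl, heq_of_eq (QuotientGroup.eq.2 ?_)⟩
    simpa [mul_assoc, toPt] using hmem

theorem toPt_eq_iff (a : V) (x y : Point V K) :
    C.toPt a x = C.toPt a y ↔ C.SamePoint a x y := by
  simpa [SamePoint] using C.inv_smul_toPt_eq_iff a 1 x y

theorem toPt_shift (a : V) (x : Point V K) (w : Word K) :
    C.toPt a (shift x w) = (evalWord (C.gen a) w)⁻¹ • C.toPt a x := by
  rw [eq_comm, inv_smul_toPt_eq_iff]
  simp [shift, one_mem]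

theorem evalWord_αWord_mk {a b : V} (e : a ⟶ b) (c : A.edgeGroup e) :
    evalWord (C.gen a) (C.αWord ⟨⟨a, b, e⟩, c⟩) = A.α e c :=
  C.evalWord_αWord ⟨⟨a, b, e⟩, c⟩

theorem evalWord_ωWord_mk {a b : V} (e : a ⟶ b) (c : A.edgeGroup e) :
    evalWord (C.gen b) (C.ωWord ⟨⟨a, b, e⟩, c⟩) = A.ω e c :=
  C.evalWord_ωWord ⟨⟨a, b, e⟩, c⟩

variable (V K) in
/-- An edge together with names of a point over its origin and of a point over its terminus. -/
abbrev Arrow := TotalEdge V × Point V K × Point V K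

/-- The arrow from the second to the first point of an arrow, over the reverse edge. -/
def Arrow.reverse (t : Arrow V K) : Arrow V K := (t.1.rev, t.2.2, t.2.1)

/-- A list of arrows is valid if it is closed under reversal and the translates of its arrows by
elements of the edge groups define partial bijections. -/
def Valid (E : List (Arrow V K)) : Prop :=
  (∀ t ∈ E, Arrow.reverse t ∈ E) ∧
    ∀ t ∈ E, ∀ t' ∈ E, ∀ c : A.EdgeElement, t.1 = c.1 → t'.1 = c.1 →
      C.SamePoint c.1.1 (shift t.2.1 (C.αWord c)) t'.2.1 →
        C.SamePoint c.1.2.1 (shift t.2.2 (C.ωWord c)) t'.2.2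

variable {C} in
/-- The partial action that is defined by a valid list of arrows. -/
def Valid.partialAction {E : List (Arrow V K)} (hE : C.Valid E) :
    A.PartialAction where
  Pt a := Σ o : Label V K, A.vertexGroup a ⧸ wordSubgroup (C.gen a) o.2
  Step {a b} e X Y := ∃ t ∈ E, t.1 = ⟨a, b, e⟩ ∧ ∃ c : A.edgeGroup e,
    X = (A.α e c)⁻¹ • C.toPt a t.2.1 ∧ Y = (A.ω e c)⁻¹ • C.toPt b t.2.2
  step_unique := by
    rintro a b e X Y Z ⟨t, ht, hte, c, rfl, rfl⟩ ⟨t', ht', hte', c', h, rfl⟩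
    have hvalid := hE.2 t ht t' ht' ⟨⟨a, b, e⟩, c * c'⁻¹⟩ hte hte'
    simp only [← toPt_eq_iff, toPt_shift, evalWord_αWord_mk, evalWord_ωWord_mk] at hvalid
    rw [inv_smul_eq_iff, smul_smul, ← map_inv, ← map_mul, ← inv_smul_eq_iff, ← map_inv] at h
    rw [inv_smul_eq_iff, smul_smul, ← map_inv, ← map_mul, ← inv_smul_eq_iff]
    exact hvalid (by simpa using h)
  step_smul := by
    rintro a b e X Y d ⟨t, ht, hte, c, rfl, rfl⟩
    exact ⟨t, ht, hte, c * d⁻¹, by simp [mul_smul], by simp [mul_smul]⟩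
  step_reverse := by
    rintro a b e X Y ⟨t, ht, hte, c, rfl, rfl⟩
    refine ⟨_, hE.1 t ht, by rw [Arrow.reverse, hte]; rfl, A.rev e c, ?_, ?_⟩
    · rw [A.α_rev]; rfl
    · rw [A.ω_rev]; rfl

section Tracing

variable {C} {E : List (Arrow V K)}

/-- The point of the partial action of a valid list that is named `x`. -/
def Valid.pt (hE : C.Valid E) (a : V) (x : Point V K) : hE.partialAction.Pt a := C.toPt a x

theorem Valid.inv_smul_pt_eq_iff (hE : C.Valid E) {a : V} {g : A.vertexGroup a} {x y : Point V K} :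
    g⁻¹ • hE.pt a x = hE.pt a y ↔ x.1 = y.1 ∧
      evalWord (C.gen a) x.2 * g * (evalWord (C.gen a) y.2)⁻¹ ∈ wordSubgroup (C.gen a) x.1.2 :=
  C.inv_smul_toPt_eq_iff a g x y

theorem Valid.pt_eq_iff (hE : C.Valid E) {a : V} {x y : Point V K} :
    hE.pt a x = hE.pt a y ↔ C.SamePoint a x y :=
  C.toPt_eq_iff a x y

theorem Valid.pt_shift (hE : C.Valid E) (a : V) (x : Point V K) (w : Word K) :
    hE.pt a (shift x w) = (evalWord (C.gen a) w)⁻¹ • hE.pt a x :=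
  C.toPt_shift a x w

theorem Valid.step_iff (hE : C.Valid E) {a b : V} {e : a ⟶ b}
    {X : hE.partialAction.Pt a} {Y : hE.partialAction.Pt b} : hE.partialAction.Step e X Y ↔
      ∃ t ∈ E, t.1 = ⟨a, b, e⟩ ∧ ∃ c : A.edgeGroup e,
        X = hE.pt a (shift t.2.1 (C.αWord ⟨⟨a, b, e⟩, c⟩)) ∧
        Y = hE.pt b (shift t.2.2 (C.ωWord ⟨⟨a, b, e⟩, c⟩)) := by
  simp only [pt_shift, evalWord_αWord_mk, evalWord_ωWord_mk]
  rfl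

variable (C E) in
/-- The machine that traces a word through the partial action. The point `none` means that the
trace has left the domain. -/
inductive TraceStep :
    V × Option (Point V K) → Letter V K × Bool → V × Option (Point V K) → Prop
  | vertex (a : V) (k : K) (β : Bool) (ζ : Option (Point V K)) :
      TraceStep (a, ζ) (Sum.inl (a, k), β) (a, ζ.map fun x => shift x [(k, β)])
  | edge {a b : V} (e : a ⟶ b) (c : A.edgeGroup e) (x : Point V K)
      (t : Arrow V K) : t ∈ E → t.1 = ⟨a, b, e⟩ →
      C.SamePoint a x (shift t.2.1 (C.αWord ⟨⟨a, b, e⟩, c⟩)) →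
      TraceStep (a, some x) (Sum.inr ⟨a, b, e⟩, true)
        (b, some (shift t.2.2 (C.ωWord ⟨⟨a, b, e⟩, c⟩)))
  | stuck {a b : V} (e : a ⟶ b) (x : Point V K) :
      (∀ t ∈ E, ∀ c : A.EdgeElement, t.1 = c.1 → c.1 = ⟨a, b, e⟩ →
        ¬ C.SamePoint a x (shift t.2.1 (C.αWord c))) →
      TraceStep (a, some x) (Sum.inr ⟨a, b, e⟩, true) (b, none)
  | dead {a b : V} (e : a ⟶ b) : TraceStep (a, none) (Sum.inr ⟨a, b, e⟩, true) (b, none)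

theorem PathWord.exists_run {a b : V} {p : A.GPath a b} {f : Word (Letter V K)}
    (h : C.PathWord p f) (ζ : Option (Point V K)) :
    ∃ ξ, Run (C.TraceStep E) (a, ζ) f (b, ξ) := by
  induction h generalizing ζ with
  | nil a => exact ⟨ζ, Run.nil _⟩
  | vertex k β _ ih =>
    obtain ⟨ξ, hξ⟩ := ih (ζ.map fun x => shift x [(k, β)])
    exact ⟨ξ, Run.cons (TraceStep.vertex _ k β ζ) hξ⟩
  | @edge a b d e _ _ _ ih =>
    cases ζ with
    | none =>
      obtain ⟨ξ, hξ⟩ := ih none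
      exact ⟨ξ, Run.cons (TraceStep.dead e) hξ⟩
    | some x =>
      by_cases hstuck : ∀ t ∈ E, ∀ c : A.EdgeElement, t.1 = c.1 → c.1 = ⟨a, b, e⟩ →
        ¬ C.SamePoint a x (shift t.2.1 (C.αWord c))
      · obtain ⟨ξ, hξ⟩ := ih none
        exact ⟨ξ, Run.cons (TraceStep.stuck e x hstuck) hξ⟩
      · push Not at hstuck
        obtain ⟨t, ht, ⟨_, c⟩, hte, rfl, hx⟩ := hstuck
        obtain ⟨ξ, hξ⟩ := ih (some (shift t.2.2 (C.ωWord ⟨⟨a, b, e⟩, c⟩)))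
        exact ⟨ξ, Run.cons (TraceStep.edge e c x t ht hte hx) hξ⟩

theorem exists_pathWord_of_run {a b : V} {f : Word (Letter V K)} {ζ ξ : Option (Point V K)}
    (h : Run (C.TraceStep E) (a, ζ) f (b, ξ)) : ∃ p : A.GPath a b, C.PathWord p f := by
  induction f generalizing a ζ with
  | nil =>
    cases h
    exact ⟨_, PathWord.nil _⟩
  | cons l f ih =>
    obtain ⟨⟨d, θ⟩, hstep, hrun⟩ := run_cons_iff.1 h
    obtain ⟨p, hp⟩ := ih hrun
    cases hstep with
    | vertex => exact ⟨_, hp.vertex _ _⟩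
    | edge e => exact ⟨_, hp.edge e⟩
    | stuck e => exact ⟨_, hp.edge e⟩
    | dead e => exact ⟨_, hp.edge e⟩

theorem run_none {a b : V} {f : Word (Letter V K)} {ξ : Option (Point V K)}
    (h : Run (C.TraceStep E) (a, none) f (b, ξ)) : ξ = none := by
  induction f generalizing a with
  | nil =>
    cases h
    rfl
  | cons l f ih =>
    obtain ⟨⟨d, θ⟩, hstep, hrun⟩ := run_cons_iff.1 h
    cases hstep with
    | vertex => exact ih hrun
    | dead e => exact ih hrun

theorem PathWord.moves_iff {a b : V} {p : A.GPath a b} {f : Word (Letter V K)}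
    (h : C.PathWord p f) (hE : C.Valid E) {x : Point V K} {ξ : Option (Point V K)}
    (hr : Run (C.TraceStep E) (a, some x) f (b, ξ)) (Y : hE.partialAction.Pt b) :
    hE.partialAction.Moves p (hE.pt a x) Y ↔ ∃ y, ξ = some y ∧ hE.pt b y = Y := by
  induction h generalizing x with
  | nil a =>
    cases hr
    simp only [PartialAction.Moves, inv_one, one_smul]
    simp
  | vertex k β _ ih =>
    obtain ⟨⟨d, θ⟩, hstep, hrun⟩ := run_cons_iff.1 hr
    cases hstep
    rw [← ih hrun, PartialAction.moves_lmul, ← hE.pt_shift]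
  | @edge a b d e _ _ _ ih =>
    obtain ⟨⟨d, θ⟩, hstep, hrun⟩ := run_cons_iff.1 hr
    simp only [PartialAction.Moves, inv_one, one_smul]
    cases hstep with
    | edge _ c _ t ht hte hx =>
      rw [← ih hrun]
      have hxt : hE.partialAction.Step e (hE.pt a x)
          (hE.pt b (shift t.2.2 (C.ωWord ⟨⟨a, b, e⟩, c⟩))) :=
        hE.step_iff.2 ⟨t, ht, hte, c, hE.pt_eq_iff.2 hx, rfl⟩
      constructor
      · rintro ⟨z, hz, hY⟩
        obtain rfl := hE.partialAction.step_unique hxt hz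
        exact hY
      · exact fun hY => ⟨_, hxt, hY⟩
    | stuck _ _ hstuck =>
      obtain rfl := run_none hrun
      refine iff_of_false ?_ (by simp)
      rintro ⟨z, hz, -⟩
      obtain ⟨t, ht, hte, c, hx, -⟩ := hE.step_iff.1 hz
      exact hstuck t ht ⟨⟨a, b, e⟩, c⟩ hte rfl (hE.pt_eq_iff.1 hx)

end Tracing

/-! ### Recognizing reduced words -/

section ReducedWords

/-- The machine that reads the words of reduced paths. It remembers the last edge and the word
that follows it. -/
inductive ReducedStep : V × Option (TotalEdge V) × Word K → Letter V K × Bool →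
    V × Option (TotalEdge V) × Word K → Prop
  | vertex (a : V) (k : K) (β : Bool) (o : Option (TotalEdge V)) (w : Word K) :
      ReducedStep (a, o, w) (Sum.inl (a, k), β) (a, o, w ++ [(k, β)])
  | edge {a b : V} (e : a ⟶ b) (o : Option (TotalEdge V)) (w : Word K) :
      (∀ c : A.EdgeElement, o = some c.1 → c.1.rev = ⟨a, b, e⟩ →
        evalWord (C.gen c.1.2.1) w ≠ evalWord (C.gen c.1.2.1) (C.ωWord c)) →
      ReducedStep (a, o, w) (Sum.inr ⟨a, b, e⟩, true) (b, some ⟨a, b, e⟩, [])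

/-- The word `f` spells a reduced path from `a` to `b`. -/
def IsReducedWord (a b : V) (f : Word (Letter V K)) : Prop :=
  ∃ t, Run C.ReducedStep (a, none, []) f (b, t)

variable {C}

theorem exists_pathWord_of_run_reducedStep {a b : V} {f : Word (Letter V K)}
    {s t : Option (TotalEdge V) × Word K} (h : Run C.ReducedStep (a, s) f (b, t)) :
    ∃ p : A.GPath a b, C.PathWord p f := by
  induction f generalizing a s with
  | nil =>
    cases h
    exact ⟨_, PathWord.nil _⟩
  | cons l f ih =>
    obtain ⟨⟨d, θ⟩, hstep, hrun⟩ := run_cons_iff.1 h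
    obtain ⟨p, hp⟩ := ih hrun
    cases hstep with
    | vertex => exact ⟨_, hp.vertex _ _⟩
    | edge e => exact ⟨_, hp.edge e⟩

theorem cancels_lmul_cons_one_iff {a b d a' : V} {e : a ⟶ b} {e' : a' ⟶ a} {w : Word K}
    {p : A.GPath b d} : Cancels e' (lmul (evalWord (C.gen a) w) (cons 1 e p)) ↔
      ∃ c : A.EdgeElement, (⟨a', a, e'⟩ : TotalEdge V) = c.1 ∧ c.1.rev = ⟨a, b, e⟩ ∧
        evalWord (C.gen c.1.2.1) w = evalWord (C.gen c.1.2.1) (C.ωWord c) := by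
  constructor
  · rintro ⟨c, q, h⟩
    simp only [lmul, cons.injEq, mul_one] at h
    obtain ⟨rfl, hw, he, -⟩ := h
    obtain rfl := eq_of_heq he
    exact ⟨⟨⟨b, a, e'⟩, c⟩, rfl, rfl, by rw [evalWord_ωWord, hw]⟩
  · rintro ⟨⟨_, c⟩, rfl, he, hw⟩
    cases he
    rw [evalWord_ωWord] at hw
    exact ⟨c, p, by rw [hw, lmul, mul_one]⟩

theorem exists_run_reducedStep_vertex_iff {a b : V} {k : K} {β : Bool} {f : Word (Letter V K)}
    {o : Option (TotalEdge V)} {w : Word K} :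
    (∃ t, Run C.ReducedStep (a, o, w) ((Sum.inl (a, k), β) :: f) (b, t)) ↔
      ∃ t, Run C.ReducedStep (a, o, w ++ [(k, β)]) f (b, t) := by
  constructor
  · rintro ⟨t, ht⟩
    obtain ⟨s, hs, hrun⟩ := run_cons_iff.1 ht
    cases hs
    exact ⟨t, hrun⟩
  · exact fun ⟨t, ht⟩ => ⟨t, Run.cons (ReducedStep.vertex _ k β o w) ht⟩

theorem exists_run_reducedStep_edge_iff {a b d : V} {e : a ⟶ b} {f : Word (Letter V K)}
    {o : Option (TotalEdge V)} {w : Word K} (p : A.GPath b d) :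
    (∃ t, Run C.ReducedStep (a, o, w) ((Sum.inr ⟨a, b, e⟩, true) :: f) (d, t)) ↔
      (∃ t, Run C.ReducedStep (b, some ⟨a, b, e⟩, []) f (d, t)) ∧
      ∀ (a' : V) (e' : a' ⟶ a), o = some ⟨a', a, e'⟩ →
        ¬ Cancels e' (lmul (evalWord (C.gen a) w) (cons 1 e p)) := by
  simp only [cancels_lmul_cons_one_iff]
  constructor
  · rintro ⟨t, ht⟩
    obtain ⟨s, hs, hrun⟩ := run_cons_iff.1 ht
    cases hs with
    | edge _ _ _ hw =>
      refine ⟨⟨t, hrun⟩, ?_⟩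
      rintro a' e' rfl ⟨c, hc, hce, hcw⟩
      exact hw c (congrArg some hc) hce hcw
  · rintro ⟨⟨t, ht⟩, hcancels⟩
    refine ⟨t, Run.cons (ReducedStep.edge e o w ?_) ht⟩
    rintro ⟨⟨a', a'', e'⟩, c⟩ rfl he hw
    cases he
    exact hcancels a' e' rfl ⟨_, rfl, rfl, hw⟩

theorem PathWord.exists_run_reducedStep_iff {a b : V} {p : A.GPath a b} {f : Word (Letter V K)}
    (hp : C.PathWord p f) (o : Option (TotalEdge V)) (w : Word K) :
    (∃ t, Run C.ReducedStep (a, o, w) f (b, t)) ↔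
      Reduced p ∧ ∀ (a' : V) (e' : a' ⟶ a), o = some ⟨a', a, e'⟩ →
        ¬ Cancels e' (lmul (evalWord (C.gen a) w) p) := by
  induction hp generalizing o w with
  | nil a =>
    refine iff_of_true ⟨_, Run.nil _⟩ ⟨trivial, ?_⟩
    rintro a' e' - ⟨c, q, h⟩
    simp [lmul] at h
  | vertex k β _ ih =>
    rw [exists_run_reducedStep_vertex_iff, ih, reduced_lmul, lmul_lmul, evalWord_append]
  | @edge a b d e p f _ ih =>
    rw [exists_run_reducedStep_edge_iff p, ih, evalWord_nil, one_lmul]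
    have hlast : (∀ (a' : V) (e' : a' ⟶ b), some (⟨a, b, e⟩ : TotalEdge V) = some ⟨a', b, e'⟩ →
        ¬ Cancels e' p) ↔ ¬ Cancels e p := by
      refine ⟨fun h => h a e rfl, ?_⟩
      rintro h a' e' he
      cases he
      exact h
    rw [hlast, and_comm (a := Reduced p)]
    rfl

theorem PathWord.isReducedWord_iff {a b : V} {p : A.GPath a b} {f : Word (Letter V K)}
    (hp : C.PathWord p f) : C.IsReducedWord a b f ↔ Reduced p := by
  simp [IsReducedWord, hp.exists_run_reducedStep_iff]

end ReducedWords

/-! ### Certificates for negative instances -/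

section Certificates

/-- The traces of the positive powers of `c` that start at `x` do not end at `y`. The list `Z`
witnesses this: it is closed under `c` and contains the ends of the traces. -/
def Evades (E : List (Arrow V K)) (a : V) (c : Word (Letter V K)) (x y : Point V K) : Prop :=
  ∃ Z : List (Point V K), (∀ ζ ∈ x :: Z, Run (C.TraceStep E) (a, some ζ) c (a, none) ∨
    ∃ ζ' ∈ Z, Run (C.TraceStep E) (a, some ζ) c (a, some ζ')) ∧ ∀ ζ ∈ Z, ¬ C.SamePoint a ζ y

/-- Some non-zero power of the element of the vertex group with the word `w` takes `x` to `y`. -/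
def PowerHits (a : V) (w : Word K) (x y : Point V K) : Prop :=
  x.1 = y.1 ∧ ∃ m : ℤ, m ≠ 0 ∧
    evalWord (C.gen a) x.2 * evalWord (C.gen a) w ^ m * (evalWord (C.gen a) y.2)⁻¹ ∈
      wordSubgroup (C.gen a) x.1.2

/-- A certificate that no non-zero power of the loop with the word `c` takes `x` to `y`. The loop
either has no edges or is cyclically reduced, so that its powers are reduced and are traced
whenever an equivalent path is. -/
def PowersAvoid (E : List (Arrow V K)) (a : V) (c : Word (Letter V K)) (x y : Point V K) : Prop :=
  (∃ w, c = vertexWord a w ∧ ¬ C.PowerHits a w x y) ∨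
    (C.IsReducedWord a a c ∧ C.IsReducedWord a a (c ++ c) ∧ C.Evades E a c x y ∧ C.Evades E a c y x)

/-- The values of the words in `L` are the classes of loops that fix the point `q`. -/
def Stabilizes (v₀ : V) (E : List (Arrow V K)) (q : Point V K) (L : List (Word (Letter V K))) :
    Prop :=
  ∀ l ∈ L, ∃ (f : Word (Letter V K)) (r : Point V K),
    evalWord (C.letter v₀) l = evalWord (C.letter v₀) f ∧
    Run (C.TraceStep E) (v₀, some q) f (v₀, some r) ∧ C.SamePoint v₀ r q

/-- There is a certificate for a negative answer to an instance `(x, g, L)`: a finite partial action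
with a point `q` that `L` fixes, and a loop `c` that is conjugate to `g` by the path `y` and whose
powers do not take `q z` to `q y`, where `x z = y`. -/
def Refutable (v₀ : V) (I : PowerCosetQuery (Letter V K)) : Prop :=
  ∃ (E : List (Arrow V K)) (q : Point V K), C.Valid E ∧ C.Stabilizes v₀ E q I.2.2 ∧
    ∃ (a : V) (z y c : Word (Letter V K)) (p r : Point V K),
      evalWord (C.letter v₀) (I.1 ++ z) = evalWord (C.letter v₀) y ∧
      evalWord (C.letter v₀) (I.2.1 ++ y) = evalWord (C.letter v₀) (y ++ c) ∧
      Run (C.TraceStep E) (v₀, some q) z (a, some p) ∧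
      Run (C.TraceStep E) (v₀, some q) y (a, some r) ∧ C.PowersAvoid E a c p r

variable {C}

theorem Evades.not_moves {E : List (Arrow V K)} {a : V} {f : Word (Letter V K)} {x y : Point V K}
    (h : C.Evades E a f x y) (hE : C.Valid E) {c : A.GPath a a} (hc : C.PathWord c f) (n : ℕ) :
    ¬ hE.partialAction.Moves (powSucc c n) (hE.pt a x) (hE.pt a y) := by
  obtain ⟨Z, hZ, hZy⟩ := h
  have moves_mem : ∀ ζ ∈ x :: Z, ∀ Y, hE.partialAction.Moves c (hE.pt a ζ) Y →
      ∃ ζ' ∈ Z, hE.pt a ζ' = Y := by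
    intro ζ hζ Y hY
    rcases hZ ζ hζ with hrun | ⟨ζ', hζ', hrun⟩
    · simp [hc.moves_iff hE hrun] at hY
    · obtain ⟨_, ⟨⟩, rfl⟩ := (hc.moves_iff hE hrun Y).1 hY
      exact ⟨ζ', hζ', rfl⟩
  have moves_powSucc_mem : ∀ n, ∀ ζ ∈ x :: Z, ∀ Y,
      hE.partialAction.Moves (powSucc c n) (hE.pt a ζ) Y → ∃ ζ' ∈ Z, hE.pt a ζ' = Y := by
    intro n
    induction n with
    | zero => exact moves_mem
    | succ n ih =>
      intro ζ hζ Y hY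
      obtain ⟨W, hW, hWY⟩ := PartialAction.moves_append.1 hY
      obtain ⟨ζ', hζ', rfl⟩ := moves_mem ζ hζ W hW
      exact ih ζ' (List.mem_cons_of_mem _ hζ') Y hWY
  intro hxy
  obtain ⟨ζ, hζ, hζy⟩ := moves_powSucc_mem n x List.mem_cons_self _ hxy
  exact hZy ζ hζ (hE.pt_eq_iff.1 hζy)

theorem PowersAvoid.exists_pathWord {E : List (Arrow V K)} {v₀ a : V} {f : Word (Letter V K)}
    {x y : Point V K} (h : C.PowersAvoid E a f x y) (hE : C.Valid E) (γ : A.GPath v₀ a) :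
    ∃ c : A.GPath a a, C.PathWord c f ∧ ∀ (m : ℤ) (q : A.GPath a a), m ≠ 0 →
      transport v₀ q = transport v₀ c ^ m →
        ¬ hE.partialAction.Moves q (hE.pt a x) (hE.pt a y) := by
  rcases h with ⟨w, rfl, hw⟩ | ⟨hf, hff, hxy, hyx⟩
  · refine ⟨_, C.pathWord_vertexWord a w, fun m q hm hq hmoves => hw ?_⟩
    rw [← vertexHom_apply, ← map_zpow, vertexHom_apply] at hq
    have nil_reduced : Reduced (nil (evalWord (C.gen a) w ^ m)) := trivial
    have nil_moves := hmoves.of_transport_eq γ nil_reduced hq.symm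
    obtain ⟨hlabel, hmem⟩ := hE.inv_smul_pt_eq_iff.1 nil_moves
    exact ⟨hlabel, m, hm, hmem⟩
  · obtain ⟨c, hc⟩ := exists_pathWord_of_run_reducedStep hf.choose_spec
    have hcred : CyclicallyReduced c :=
      ⟨hc.isReducedWord_iff.1 hf, (hc.append hc).isReducedWord_iff.1 hff⟩
    refine ⟨c, hc, fun m q hm hq hmoves => ?_⟩
    rcases lt_or_gt_of_ne hm with hm | hm
    · obtain ⟨n, rfl⟩ : ∃ n : ℕ, m = -(n + 1 : ℕ) := ⟨(-m - 1).toNat, by omega⟩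
      refine hyx.not_moves hE hc n (hmoves.inv.of_transport_eq γ (hcred.reduced_powSucc n) ?_)
      rw [transport_inv, hq, transport_powSucc, zpow_neg, zpow_natCast, inv_inv]
    · obtain ⟨n, rfl⟩ : ∃ n : ℕ, m = (n + 1 : ℕ) := ⟨(m - 1).toNat, by omega⟩
      refine hxy.not_moves hE hc n (hmoves.of_transport_eq γ (hcred.reduced_powSucc n) ?_)
      rw [hq, transport_powSucc, zpow_natCast]

theorem Stabilizes.exists_moves {v₀ : V} {E : List (Arrow V K)} {q : Point V K}
    {L : List (Word (Letter V K))} (hL : C.Stabilizes v₀ E q L) (hE : C.Valid E)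
    {h : A.FundamentalGroup v₀} (hh : h ∈ wordSubgroup (C.letter v₀) L) :
    ∃ η : A.GPath v₀ v₀, loopClass η = h ∧
      hE.partialAction.Moves η (hE.pt v₀ q) (hE.pt v₀ q) := by
  refine PartialAction.exists_moves_of_mem_closure ?_ hh
  rintro _ ⟨l, hl, rfl⟩
  obtain ⟨f, r, hlf, hrun, hrq⟩ := hL l hl
  obtain ⟨η, hη⟩ := exists_pathWord_of_run hrun
  refine ⟨η, ?_, (hη.moves_iff hE hrun _).2 ⟨_, rfl, hE.pt_eq_iff.2 hrq⟩⟩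
  rw [hlf, hη.evalWord_eq, transport_loop]

theorem Refutable.not_powerCoset {v₀ : V} {I : PowerCosetQuery (Letter V K)}
    (h : C.Refutable v₀ I) : ¬ PowerCoset (C.letter v₀) I := by
  obtain ⟨E, q, hE, hL, a, z, y, f, p, r, hxz, hgy, hz, hy, havoid⟩ := h
  obtain ⟨zp, hzp⟩ := exists_pathWord_of_run hz
  obtain ⟨yp, hyp⟩ := exists_pathWord_of_run hy
  obtain ⟨c, hc, hpowers⟩ := havoid.exists_pathWord hE yp
  have zp_moves : hE.partialAction.Moves zp (hE.pt v₀ q) (hE.pt a p) :=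
    (hzp.moves_iff hE hz _).2 ⟨_, rfl, rfl⟩
  have yp_moves : hE.partialAction.Moves yp (hE.pt v₀ q) (hE.pt a r) :=
    (hyp.moves_iff hE hy _).2 ⟨_, rfl, rfl⟩
  rintro ⟨m, hm, hmem⟩
  obtain ⟨η, hη, η_moves⟩ := hL.exists_moves hE hmem
  rw [evalWord_append, hzp.evalWord_eq, hyp.evalWord_eq] at hxz
  rw [evalWord_append, evalWord_append, hyp.evalWord_eq, hc.evalWord_eq] at hgy
  refine hpowers m (append (GPath.inv zp) (append η yp)) hm ?_ (PartialAction.moves_append.2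
    ⟨_, zp_moves.inv, PartialAction.moves_append.2 ⟨_, η_moves, yp_moves⟩⟩)
  rw [transport_append, transport_append, transport_inv, transport_loop, hη,
    eq_mul_inv_of_mul_eq hxz, eq_mul_inv_of_mul_eq hgy, conj_zpow]
  group

end Certificates

/-! ### The coset space of a subgroup as a partial action -/

section CosetSpace

variable (v₀ : V)

theorem exists_loop_pathWord (g : A.FundamentalGroup v₀) :
    ∃ (p : A.GPath v₀ v₀) (f : Word (Letter V K)), C.PathWord p f ∧ loopClass p = g := by
  obtain ⟨p, rfl⟩ := Quotient.exists_rep g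
  obtain ⟨f, hf⟩ := C.exists_pathWord p
  exact ⟨p, f, hf, rfl⟩

theorem exists_evalWord_letter (g : A.FundamentalGroup v₀) :
    ∃ f, evalWord (C.letter v₀) f = g := by
  obtain ⟨p, f, hf, rfl⟩ := C.exists_loop_pathWord v₀ g
  exact ⟨f, by rw [hf.evalWord_eq, transport_loop]⟩

theorem closure_range_letter : Subgroup.closure (Set.range (C.letter v₀)) = ⊤ := by
  refine eq_top_iff.2 fun g _ => ?_
  obtain ⟨f, rfl⟩ := C.exists_evalWord_letter v₀ g
  exact evalWord_mem_closure _ f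

variable {v₀}

/-- An element of the chosen right coset of `H` in the orbit of `X` under the vertex group at `a`.
The right coset `H g` is encoded as the left coset of `g⁻¹`, as for `Coding.toPt`. -/
noncomputable def orbitRep {H : Subgroup (A.FundamentalGroup v₀)} (a : V)
    (X : A.FundamentalGroup v₀ ⧸ H) : A.FundamentalGroup v₀ :=
  (Quotient.out (Quotient.mk (MulAction.orbitRel (A.vertexHom v₀ a).range _) X)).out⁻¹

variable (A v₀ K) in
/-- Names of cosets: an element of the chosen coset in its orbit under a vertex group, and a word
for the element of the vertex group that takes the chosen coset to the named one. -/
abbrev CosetName := A.FundamentalGroup v₀ × Word K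

variable (A v₀ K) in
/-- An edge together with names of a coset over its origin and of a coset over its terminus. -/
abbrev CosetArrow := TotalEdge V × CosetName A K v₀ × CosetName A K v₀

/-- The arrow from the second to the first coset of an arrow, over the reverse edge. -/
def CosetArrow.reverse (t : CosetArrow A K v₀) : CosetArrow A K v₀ := (t.1.rev, t.2.2, t.2.1)

variable (H : Subgroup (A.FundamentalGroup v₀))

/-- The coset with the name `s` over the vertex `a`. -/
noncomputable def coset (a : V) (s : CosetName A K v₀) : A.FundamentalGroup v₀ ⧸ H :=
  (A.vertexHom v₀ a (evalWord (C.gen a) s.2))⁻¹ • ((s.1⁻¹ : A.FundamentalGroup v₀) : _ ⧸ H)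

/-- The name `s` of a coset over the vertex `a` uses the chosen element of the orbit. -/
def IsCanonical (a : V) (s : CosetName A K v₀) : Prop := orbitRep a (C.coset H a s) = s.1

open Classical in
/-- Those words of `S` whose values fix the coset of `r`. -/
noncomputable def stabWords (S : List (Word K)) (a : V) (r : A.FundamentalGroup v₀) :
    List (Word K) :=
  S.filter fun k => A.vertexHom v₀ a (evalWord (C.gen a) k) ∈
    MulAction.stabilizer _ ((r⁻¹ : A.FundamentalGroup v₀) : _ ⧸ H)

/-- The coset `s` as a point. The label of its orbit consists of a word for the chosen element and
of those words of `S` that stabilize the chosen coset. -/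
noncomputable def toPoint (S : List (Word K)) (a : V) (s : CosetName A K v₀) : Point V K :=
  (((C.exists_evalWord_letter v₀ s.1).choose, C.stabWords H S a s.1), s.2)

/-- The edge takes the first coset of the arrow to the second one. -/
structure IsArrow (t : CosetArrow A K v₀) : Prop where
  canonical_origin : C.IsCanonical H t.1.1 t.2.1
  canonical_terminus : C.IsCanonical H t.1.2.1 t.2.2
  smul_coset : (A.edgeElement v₀ t.1.2.2)⁻¹ • C.coset H t.1.1 t.2.1 = C.coset H t.1.2.1 t.2.2

/-- An arrow between cosets as an arrow between points. -/
noncomputable def toArrow (S : List (Word K)) (t : CosetArrow A K v₀) : Arrow V K :=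
  (t.1, C.toPoint H S t.1.1 t.2.1, C.toPoint H S t.1.2.1 t.2.2)

/-- A finite part of the coset space of `H`, with enough words in `S` for their values that
stabilize a coset to decide which translates of arrows by elements of edge groups coincide. -/
structure IsFragment (F : List (CosetArrow A K v₀)) (S : List (Word K)) : Prop where
  isArrow : ∀ t ∈ F, C.IsArrow H t
  reverse_mem : ∀ t ∈ F, t.reverse ∈ F
  word_mem : ∀ t ∈ F, ∀ t' ∈ F, ∀ c, t.2.1.2 ++ C.αWord c ++ FreeGroup.invRev t'.2.1.2 ∈ S

variable {C H}

theorem CosetArrow.reverse_reverse (t : CosetArrow A K v₀) : t.reverse.reverse = t := by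
  simp [CosetArrow.reverse, TotalEdge.rev]

theorem exists_vertexHom_smul_orbitRep (a : V) (X : A.FundamentalGroup v₀ ⧸ H) :
    ∃ k, A.vertexHom v₀ a k • (((orbitRep a X)⁻¹ : A.FundamentalGroup v₀) : _ ⧸ H) = X := by
  obtain ⟨⟨_, k, rfl⟩, hk⟩ := MulAction.orbitRel_apply.1
    (Quotient.mk_out (s := MulAction.orbitRel (A.vertexHom v₀ a).range _) X)
  refine ⟨k⁻¹, ?_⟩
  rw [map_inv, inv_smul_eq_iff, orbitRep, inv_inv, QuotientGroup.out_eq']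
  exact hk.symm

theorem orbitRep_vertexHom_smul (a : V) (k : A.vertexGroup a) (X : A.FundamentalGroup v₀ ⧸ H) :
    orbitRep a (A.vertexHom v₀ a k • X) = orbitRep a X := by
  have same_orbit : Quotient.mk (MulAction.orbitRel (A.vertexHom v₀ a).range _)
      (A.vertexHom v₀ a k • X) = Quotient.mk _ X := Quotient.sound ⟨⟨_, k, rfl⟩, rfl⟩
  rw [orbitRep, same_orbit, orbitRep]

theorem coset_append (a : V) (s : CosetName A K v₀) (l : Word K) :
    C.coset H a (s.1, s.2 ++ l) =
      (A.vertexHom v₀ a (evalWord (C.gen a) l))⁻¹ • C.coset H a s := by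
  simp [coset, mul_smul]

theorem IsCanonical.append {a : V} {s : CosetName A K v₀} (hs : C.IsCanonical H a s)
    (l : Word K) : C.IsCanonical H a (s.1, s.2 ++ l) := by
  rw [IsCanonical, coset_append, ← map_inv, orbitRep_vertexHom_smul]
  exact hs

variable (C) in
theorem exists_isCanonical_coset_eq (a : V) (X : A.FundamentalGroup v₀ ⧸ H) :
    ∃ s : CosetName A K v₀, C.IsCanonical H a s ∧ C.coset H a s = X := by
  obtain ⟨k, hk⟩ := exists_vertexHom_smul_orbitRep a X
  obtain ⟨l, hl⟩ := exists_evalWord (C.closure_gen a) k⁻¹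
  have hX : C.coset H a (orbitRep a X, l) = X := by
    rw [coset, hl, map_inv, inv_inv, hk]
  exact ⟨_, by rw [IsCanonical, hX], hX⟩

variable {S : List (Word K)} {a : V} {s t : CosetName A K v₀}

theorem mem_stabWords {r : A.FundamentalGroup v₀} {k : Word K} :
    k ∈ C.stabWords H S a r ↔ k ∈ S ∧ A.vertexHom v₀ a (evalWord (C.gen a) k) •
      ((r⁻¹ : A.FundamentalGroup v₀) : _ ⧸ H) = (r⁻¹ : A.FundamentalGroup v₀) := by
  simp [stabWords]

theorem vertexHom_smul_of_mem_wordSubgroup_stabWords {r : A.FundamentalGroup v₀}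
    {k : A.vertexGroup a} (hk : k ∈ wordSubgroup (C.gen a) (C.stabWords H S a r)) :
    A.vertexHom v₀ a k • ((r⁻¹ : A.FundamentalGroup v₀) : _ ⧸ H) =
      (r⁻¹ : A.FundamentalGroup v₀) := by
  have hle : wordSubgroup (C.gen a) (C.stabWords H S a r) ≤
      (MulAction.stabilizer _ ((r⁻¹ : A.FundamentalGroup v₀) : _ ⧸ H)).comap
        (A.vertexHom v₀ a) := by
    refine (Subgroup.closure_le _).2 ?_
    rintro _ ⟨l, hl, rfl⟩
    exact (mem_stabWords.1 hl).2
  exact hle hk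

theorem fst_eq_of_toPoint_fst_eq (h : (C.toPoint H S a s).1 = (C.toPoint H S a t).1) :
    s.1 = t.1 := by
  rw [← (C.exists_evalWord_letter v₀ s.1).choose_spec,
    ← (C.exists_evalWord_letter v₀ t.1).choose_spec]
  exact congrArg (fun o => evalWord (C.letter v₀) o.1) h

theorem inv_vertexHom_smul_coset {k : A.vertexGroup a}
    (hlabel : (C.toPoint H S a s).1 = (C.toPoint H S a t).1)
    (hk : evalWord (C.gen a) s.2 * k * (evalWord (C.gen a) t.2)⁻¹ ∈
      wordSubgroup (C.gen a) (C.toPoint H S a s).1.2) :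
    (A.vertexHom v₀ a k)⁻¹ • C.coset H a s = C.coset H a t := by
  have hfix := vertexHom_smul_of_mem_wordSubgroup_stabWords hk
  rw [map_mul, map_mul, mul_smul, mul_smul, ← eq_inv_smul_iff, ← eq_inv_smul_iff, map_inv] at hfix
  rw [coset, coset, ← hfix, fst_eq_of_toPoint_fst_eq hlabel]

theorem coset_eq_of_samePoint (h : C.SamePoint a (C.toPoint H S a s) (C.toPoint H S a t)) :
    C.coset H a s = C.coset H a t := by
  simpa using inv_vertexHom_smul_coset (k := 1) h.1 (by rw [mul_one]; exact h.2)

theorem samePoint_of_coset_eq (hs : C.IsCanonical H a s) (ht : C.IsCanonical H a t)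
    (h : C.coset H a s = C.coset H a t)
    (hS : ∃ k ∈ S, evalWord (C.gen a) k =
      evalWord (C.gen a) s.2 * (evalWord (C.gen a) t.2)⁻¹) :
    C.SamePoint a (C.toPoint H S a s) (C.toPoint H S a t) := by
  have hst : s.1 = t.1 := by rw [← hs, h, ht]
  obtain ⟨k, hkS, hk⟩ := hS
  refine ⟨by simp only [toPoint, hst], Subgroup.subset_closure ⟨k, ?_, hk⟩⟩
  refine mem_stabWords.2 ⟨hkS, ?_⟩
  rw [hk, map_mul, map_inv, mul_smul, ← eq_inv_smul_iff]
  rw [coset, coset, ← hst] at h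
  exact h.symm

theorem IsArrow.reverse {t : CosetArrow A K v₀} (h : C.IsArrow H t) : C.IsArrow H t.reverse where
  canonical_origin := h.canonical_terminus
  canonical_terminus := h.canonical_origin
  smul_coset := by
    simp only [CosetArrow.reverse, TotalEdge.rev]
    rw [edgeElement_reverse, ← h.smul_coset, smul_smul]
    simp

theorem IsArrow.inv_edgeElement_smul_coset_append {a b : V} {e : a ⟶ b}
    {s t : CosetName A K v₀} (h : C.IsArrow H (⟨a, b, e⟩, s, t)) (c : A.edgeGroup e) :
    (A.edgeElement v₀ e)⁻¹ • C.coset H a (s.1, s.2 ++ C.αWord ⟨⟨a, b, e⟩, c⟩) =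
      C.coset H b (t.1, t.2 ++ C.ωWord ⟨⟨a, b, e⟩, c⟩) := by
  rw [coset_append, coset_append, evalWord_αWord_mk, evalWord_ωWord_mk, ← h.smul_coset,
    smul_smul, smul_smul, ← mul_inv_rev, ← mul_inv_rev, vertexHom_mul_edgeElement]

theorem IsFragment.valid {F : List (CosetArrow A K v₀)} (h : C.IsFragment H F S) :
    C.Valid (F.map (C.toArrow H S)) := by
  refine ⟨?_, ?_⟩
  · rintro _ htF
    obtain ⟨t, ht, rfl⟩ := List.mem_map.1 htF
    exact List.mem_map.2 ⟨_, h.reverse_mem t ht, rfl⟩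
  · rintro _ htF _ htF' ⟨⟨a, b, e⟩, c⟩ hte hte' hsame
    obtain ⟨⟨_, s₁, s₂⟩, ht, rfl⟩ := List.mem_map.1 htF
    obtain ⟨⟨_, t₁, t₂⟩, ht', rfl⟩ := List.mem_map.1 htF'
    obtain rfl : _ = (⟨a, b, e⟩ : TotalEdge V) := hte
    obtain rfl : _ = (⟨a, b, e⟩ : TotalEdge V) := hte'
    have hs := h.isArrow _ ht
    have ht₁₂ := h.isArrow _ ht'
    have hcoset : C.coset H a (s₁.1, s₁.2 ++ C.αWord ⟨⟨a, b, e⟩, c⟩) = C.coset H a t₁ :=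
      coset_eq_of_samePoint hsame
    refine samePoint_of_coset_eq (hs.canonical_terminus.append _) ht₁₂.canonical_terminus ?_
      ⟨_, h.word_mem _ (h.reverse_mem _ ht) _ (h.reverse_mem _ ht')
        ⟨⟨b, a, Quiver.reverse e⟩, A.rev e c⟩, ?_⟩
    · rw [← ht₁₂.smul_coset, ← hcoset, ← hs.inv_edgeElement_smul_coset_append c]
    · rw [evalWord_append, evalWord_append, evalWord_invRev, evalWord_αWord_mk, A.α_rev,
        evalWord_append, evalWord_ωWord_mk]
      rfl

end CosetSpace

/-! ### Completeness of the certificates -/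

section Completeness

variable {C} {v₀ : V} {H : Subgroup (A.FundamentalGroup v₀)}

theorem PathWord.exists_arrows {a b : V} {p : A.GPath a b} {f : Word (Letter V K)}
    (hp : C.PathWord p f) {s : CosetName A K v₀} (hs : C.IsCanonical H a s) :
    ∃ (F : List (CosetArrow A K v₀)) (t : CosetName A K v₀), (∀ t ∈ F, C.IsArrow H t) ∧
      C.IsCanonical H b t ∧ (transport v₀ p)⁻¹ • C.coset H a s = C.coset H b t ∧
      ∀ (S : List (Word K)) (E : List (Arrow V K)), (∀ t ∈ F, C.toArrow H S t ∈ E) →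
        Run (C.TraceStep E) (a, some (C.toPoint H S a s)) f (b, some (C.toPoint H S b t)) := by
  induction hp generalizing s with
  | nil a =>
    refine ⟨[], s, by simp, hs, ?_, fun _ _ _ => Run.nil _⟩
    rw [transport_one, inv_one, one_smul]
  | @vertex a b k β p f _ ih =>
    obtain ⟨F, t, hF, ht, hst, hrun⟩ := ih (hs.append [(k, β)])
    refine ⟨F, t, hF, ht, ?_, fun S E hE => Run.cons (TraceStep.vertex a k β _) (hrun S E hE)⟩
    rw [← hst, coset_append, transport_lmul, mul_inv_rev, mul_smul]
  | @edge a b d e p f _ ih =>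
    obtain ⟨r, hr, hsr⟩ :=
      C.exists_isCanonical_coset_eq b ((A.edgeElement v₀ e)⁻¹ • C.coset H a s)
    obtain ⟨F, t, hF, ht, hrt, hrun⟩ := ih (hr.append (C.ωWord ⟨⟨a, b, e⟩, 1⟩))
    refine ⟨(⟨a, b, e⟩, s, r) :: F, t, ?_, ht, ?_, fun S E hE => ?_⟩
    · exact List.forall_mem_cons.2 ⟨⟨hs, hr, hsr.symm⟩, hF⟩
    · rw [← hrt, coset_append, evalWord_ωWord_mk, map_one, map_one, inv_one, one_smul, hsr,
        transport_cons_one, mul_inv_rev, mul_smul]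
    · obtain ⟨hhead, htail⟩ := List.forall_mem_cons.1 hE
      refine Run.cons (TraceStep.edge e 1 _ _ hhead rfl ⟨rfl, ?_⟩) (hrun S E htail)
      simp [shift, toArrow, evalWord_αWord_mk, one_mem]

variable {F : List (CosetArrow A K v₀)} {S : List (Word K)}

theorem PathWord.exists_eq_toPoint_of_run {a b : V} {p : A.GPath a b} {f : Word (Letter V K)}
    (hp : C.PathWord p f) (hF : C.IsFragment H F S) {s : CosetName A K v₀} {y : Point V K}
    (h : Run (C.TraceStep (F.map (C.toArrow H S))) (a, some (C.toPoint H S a s)) f (b, some y)) :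
    ∃ t, y = C.toPoint H S b t ∧ (transport v₀ p)⁻¹ • C.coset H a s = C.coset H b t := by
  induction hp generalizing s with
  | nil a =>
    cases h
    exact ⟨s, rfl, by rw [transport_one, inv_one, one_smul]⟩
  | @vertex a b k β p f _ ih =>
    obtain ⟨_, hstep, hrun⟩ := run_cons_iff.1 h
    cases hstep
    obtain ⟨t, rfl, ht⟩ := ih (s := (s.1, s.2 ++ [(k, β)])) hrun
    exact ⟨t, rfl, by rw [← ht, coset_append, transport_lmul, mul_inv_rev, mul_smul]⟩
  | @edge a b d e p f _ ih =>
    obtain ⟨_, hstep, hrun⟩ := run_cons_iff.1 h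
    cases hstep with
    | stuck => cases run_none hrun
    | edge _ c _ t ht hte hs =>
      obtain ⟨⟨_, s₁, s₂⟩, hmem, rfl⟩ := List.mem_map.1 ht
      obtain rfl : _ = (⟨a, b, e⟩ : TotalEdge V) := hte
      obtain ⟨t, rfl, ht⟩ := ih (s := (s₂.1, s₂.2 ++ C.ωWord ⟨⟨a, b, e⟩, c⟩)) hrun
      refine ⟨t, rfl, ?_⟩
      have hcoset : C.coset H a s = C.coset H a (s₁.1, s₁.2 ++ C.αWord ⟨⟨a, b, e⟩, c⟩) :=
        coset_eq_of_samePoint hs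
      rw [transport_cons_one, mul_inv_rev, mul_smul, hcoset,
        (hF.isArrow _ hmem).inv_edgeElement_smul_coset_append, ht]

theorem PathWord.exists_edge_mem {a b : V} {p : A.GPath a b} {f : Word (Letter V K)}
    (hp : C.PathWord p f) (h : p.length ≠ 0) : ∃ e : TotalEdge V, (Sum.inr e, true) ∈ f := by
  induction hp with
  | nil a => exact (h rfl).elim
  | vertex k β _ ih =>
    rw [length_lmul] at h
    obtain ⟨e, he⟩ := ih h
    exact ⟨e, List.mem_cons_of_mem _ he⟩
  | edge e _ _ => exact ⟨_, List.mem_cons_self⟩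

theorem finite_run_end [Finite A.EdgeElement] (E : List (Arrow V K))
    {f : Word (Letter V K)} (hf : ∃ e : TotalEdge V, (Sum.inr e, true) ∈ f) :
    {y : Point V K | ∃ a x b, Run (C.TraceStep E) (a, some x) f (b, some y)}.Finite := by
  induction f using List.reverseRecOn with
  | nil => simp at hf
  | append_singleton f l ih =>
    obtain ⟨l | l, β⟩ := l
    · refine ((ih (by simpa using hf)).image fun x => shift x [(l.2, β)]).subset ?_
      rintro y ⟨a, x, b, hrun⟩
      obtain ⟨⟨d, ξ⟩, hrun₀, hlast⟩ := run_append_iff.1 hrun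
      obtain ⟨_, hlast, hnil⟩ := run_cons_iff.1 hlast
      cases hnil
      generalize hy : some y = ξ' at hlast
      cases hlast with
      | vertex a' k β =>
        obtain ⟨z, rfl, rfl⟩ := Option.map_eq_some_iff.1 hy.symm
        exact ⟨z, ⟨a, x, _, hrun₀⟩, rfl⟩
    · refine (Set.Finite.image2 (fun (t : Arrow V K) (c : A.EdgeElement) =>
        shift t.2.2 (C.ωWord c)) (List.finite_toSet E) Set.finite_univ).subset ?_
      rintro y ⟨a, x, b, hrun⟩
      obtain ⟨⟨d, ξ⟩, -, hlast⟩ := run_append_iff.1 hrun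
      obtain ⟨_, hlast, hnil⟩ := run_cons_iff.1 hlast
      cases hnil
      cases hlast with
      | edge e c x' t ht => exact ⟨t, ht, _, trivial, rfl⟩

theorem finite_transGen_run [Finite A.EdgeElement] (E : List (Arrow V K)) (a : V)
    {f : Word (Letter V K)} (hf : ∃ e : TotalEdge V, (Sum.inr e, true) ∈ f) (x : Point V K) :
    {y | Relation.TransGen (fun x y => Run (C.TraceStep E) (a, some x) f (a, some y))
      x y}.Finite := by
  refine (finite_run_end (C := C) E hf).subset fun y hy => ?_
  obtain ⟨z, -, hzy⟩ := Relation.TransGen.tail'_iff.1 hy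
  exact ⟨a, z, a, hzy⟩

theorem PathWord.evades_of_finite {E : List (Arrow V K)} {a : V} {c : A.GPath a a}
    {f : Word (Letter V K)} (hc : C.PathWord c f) {x y : Point V K}
    (hfin : {z | Relation.TransGen (fun x y => Run (C.TraceStep E) (a, some x) f (a, some y))
      x z}.Finite)
    (h : ∀ z, Relation.TransGen (fun x y => Run (C.TraceStep E) (a, some x) f (a, some y)) x z →
      ¬ C.SamePoint a z y) : C.Evades E a f x y := by
  refine ⟨hfin.toFinset.toList, fun ζ hζ => ?_, by simpa using h⟩
  obtain ⟨_ | ζ', hξ⟩ := hc.exists_run (E := E) (some ζ)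
  · exact Or.inl hξ
  · refine Or.inr ⟨ζ', ?_, hξ⟩
    simp only [List.mem_cons, Finset.mem_toList, Set.Finite.mem_toFinset, Set.mem_ofPred_eq]
      at hζ ⊢
    rcases hζ with rfl | hζ
    · exact Relation.TransGen.single hξ
    · exact hζ.tail hξ

theorem PathWord.exists_eq_toPoint_of_transGen {a : V} {c : A.GPath a a} {f : Word (Letter V K)}
    (hc : C.PathWord c f) (hF : C.IsFragment H F S) {s : CosetName A K v₀} {y : Point V K}
    (h : Relation.TransGen (fun x y => Run (C.TraceStep (F.map (C.toArrow H S)))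
      (a, some x) f (a, some y)) (C.toPoint H S a s) y) :
    ∃ (n : ℕ) (t : CosetName A K v₀), y = C.toPoint H S a t ∧
      (transport v₀ c ^ (n + 1))⁻¹ • C.coset H a s = C.coset H a t := by
  induction h with
  | single h =>
    obtain ⟨t, rfl, ht⟩ := hc.exists_eq_toPoint_of_run hF h
    exact ⟨0, t, rfl, by simpa using ht⟩
  | tail _ h ih =>
    obtain ⟨n, t, rfl, ht⟩ := ih
    obtain ⟨r, rfl, hr⟩ := hc.exists_eq_toPoint_of_run hF h
    exact ⟨n + 1, r, rfl, by rw [pow_succ _ (n + 1), mul_inv_rev, mul_smul, ht, hr]⟩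

theorem IsFragment.evades [Finite A.EdgeElement] (hF : C.IsFragment H F S) {a : V}
    {c : A.GPath a a} {f : Word (Letter V K)} (hc : C.PathWord c f) (hl : c.length ≠ 0)
    {s t : CosetName A K v₀}
    (h : ∀ n : ℕ, (transport v₀ c ^ (n + 1))⁻¹ • C.coset H a s ≠ C.coset H a t) :
    C.Evades (F.map (C.toArrow H S)) a f (C.toPoint H S a s) (C.toPoint H S a t) := by
  refine hc.evades_of_finite (finite_transGen_run _ a (hc.exists_edge_mem hl) _) ?_
  intro ζ hζ hsame
  obtain ⟨n, r, rfl, hr⟩ := hc.exists_eq_toPoint_of_transGen hF hζ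
  exact h n (hr.trans (coset_eq_of_samePoint hsame))

theorem not_powerHits_of_forall {a : V} {w : Word K} {s t : CosetName A K v₀}
    (h : ∀ m : ℤ, m ≠ 0 → (A.vertexHom v₀ a (evalWord (C.gen a) w) ^ m)⁻¹ • C.coset H a s ≠
      C.coset H a t) : ¬ C.PowerHits a w (C.toPoint H S a s) (C.toPoint H S a t) := by
  rintro ⟨hlabel, m, hm, hmem⟩
  exact h m hm (by rw [← map_zpow]; exact inv_vertexHom_smul_coset hlabel hmem)

theorem exists_pathWord_powersAvoid [Finite A.EdgeElement] {a : V} {c : A.GPath a a}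
    (hc : CyclicallyReduced c) : ∃ f, C.PathWord c f ∧
      ∀ (F : List (CosetArrow A K v₀)) (S : List (Word K)) (s t : CosetName A K v₀),
        C.IsFragment H F S →
        (∀ m : ℤ, m ≠ 0 → (transport v₀ c ^ m)⁻¹ • C.coset H a s ≠ C.coset H a t) →
        C.PowersAvoid (F.map (C.toArrow H S)) a f (C.toPoint H S a s) (C.toPoint H S a t) := by
  by_cases hl : c.length = 0
  · obtain ⟨k, rfl⟩ : ∃ k, c = nil k := by
      cases c with
      | nil k => exact ⟨k, rfl⟩
      | cons => simp [length] at hl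
    obtain ⟨w, rfl⟩ := exists_evalWord (C.closure_gen a) k
    exact ⟨_, C.pathWord_vertexWord a w, fun _ _ _ _ _ h =>
      Or.inl ⟨w, rfl, not_powerHits_of_forall h⟩⟩
  · obtain ⟨f, hf⟩ := C.exists_pathWord c
    refine ⟨f, hf, fun F S s t hF h => Or.inr ⟨hf.isReducedWord_iff.2 hc.1,
      (hf.append hf).isReducedWord_iff.2 hc.2, hF.evades hf hl fun n hn => ?_,
      hF.evades hf hl fun n hn => ?_⟩⟩
    · exact h (n + 1 : ℕ) (by omega) (by rwa [zpow_natCast])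
    · refine h (-(n + 1 : ℕ)) (by omega) ?_
      rw [zpow_neg, zpow_natCast, inv_inv, ← hn, smul_inv_smul]

theorem exists_isFragment [Finite A.EdgeElement] {F₀ : List (CosetArrow A K v₀)}
    (hF₀ : ∀ t ∈ F₀, C.IsArrow H t) (S₀ : List (Word K)) :
    ∃ F S, C.IsFragment H F S ∧ F₀ ⊆ F ∧ S₀ ⊆ S := by
  let F := F₀ ++ F₀.map CosetArrow.reverse
  have hfin : (Set.image2 (fun (t : _ × A.EdgeElement) t' =>
      t.1.2.1.2 ++ C.αWord t.2 ++ FreeGroup.invRev t'.2.1.2)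
      ({t | t ∈ F} ×ˢ Set.univ) {t | t ∈ F}).Finite :=
    Set.Finite.image2 _ ((List.finite_toSet F).prod Set.finite_univ) (List.finite_toSet F)
  refine ⟨F, S₀ ++ hfin.toFinset.toList, ⟨?_, ?_, ?_⟩, List.subset_append_left _ _,
    List.subset_append_left _ _⟩
  · refine List.forall_mem_append.2 ⟨hF₀, List.forall_mem_map.2 fun t ht => (hF₀ t ht).reverse⟩
  · refine List.forall_mem_append.2 ⟨fun t ht => ?_, List.forall_mem_map.2 fun t ht => ?_⟩
    · exact List.mem_append_right _ (List.mem_map_of_mem ht)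
    · rw [CosetArrow.reverse_reverse]
      exact List.mem_append_left _ ht
  · intro t ht t' ht' c
    refine List.mem_append_right _ ?_
    rw [Finset.mem_toList, Set.Finite.mem_toFinset]
    exact ⟨(t, c), ⟨ht, trivial⟩, t', ht', rfl⟩

theorem exists_isFragment_stabilizes [Finite A.EdgeElement] {s₀ : CosetName A K v₀}
    (hs₀ : C.IsCanonical H v₀ s₀) {L : List (Word (Letter V K))}
    (hL : ∀ l ∈ L, (evalWord (C.letter v₀) l)⁻¹ • C.coset H v₀ s₀ = C.coset H v₀ s₀)
    {F₀ : List (CosetArrow A K v₀)} (hF₀ : ∀ t ∈ F₀, C.IsArrow H t) :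
    ∃ F S, C.IsFragment H F S ∧ F₀ ⊆ F ∧
      C.Stabilizes v₀ (F.map (C.toArrow H S)) (C.toPoint H S v₀ s₀) L := by
  choose p f hpf hp using fun l => C.exists_loop_pathWord v₀ (evalWord (C.letter v₀) l)
  choose Fl tl hFl htl hval hrun using fun l => (hpf l).exists_arrows hs₀
  obtain ⟨F, S, hF, hsub, hS⟩ := exists_isFragment
    (List.forall_mem_append.2 ⟨hF₀, List.forall_mem_flatMap.2 fun l (_ : l ∈ L) => hFl l⟩)
    (L.map fun l => (tl l).2 ++ FreeGroup.invRev s₀.2)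
  rw [List.append_subset] at hsub
  refine ⟨F, S, hF, hsub.1, fun l hl => ⟨f l, C.toPoint H S v₀ (tl l), ?_, ?_, ?_⟩⟩
  · rw [(hpf l).evalWord_eq, transport_loop, hp]
  · exact hrun l S _ fun t ht =>
      List.mem_map_of_mem (hsub.2 (List.mem_flatMap.2 ⟨l, hl, ht⟩))
  · refine samePoint_of_coset_eq (htl l) hs₀ ?_ ⟨_, hS (List.mem_map_of_mem hl), ?_⟩
    · rw [← hval, transport_loop, hp, hL l hl]
    · rw [evalWord_append, evalWord_invRev]

theorem exists_transport_eq_mul {a : V} (g : A.FundamentalGroup v₀) (y : A.GPath v₀ a) :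
    ∃ z : A.GPath v₀ a, transport v₀ z = g * transport v₀ y := by
  obtain ⟨p, rfl⟩ := Quotient.exists_rep g
  exact ⟨append p y, by rw [transport_append, transport_loop]; rfl⟩

theorem exists_cyclicallyReduced_conj (g : A.FundamentalGroup v₀) :
    ∃ (a : V) (y : A.GPath v₀ a) (c : A.GPath a a), CyclicallyReduced c ∧
      g * transport v₀ y = transport v₀ y * transport v₀ c := by
  obtain ⟨p, rfl⟩ := Quotient.exists_rep g
  obtain ⟨a, c, ⟨y, hpy⟩, hc⟩ := exists_conjugate_cyclicallyReduced p
  refine ⟨a, y, c, hc, ?_⟩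
  rw [← transport_append, ← transport_congr v₀ hpy, transport_append, transport_loop]
  rfl

theorem refutable_of_not_powerCoset [Finite A.EdgeElement] {I : PowerCosetQuery (Letter V K)}
    (hI : ¬ PowerCoset (C.letter v₀) I) : C.Refutable v₀ I := by
  obtain ⟨x, g, L⟩ := I
  obtain ⟨a, y, c, hc, hgy⟩ := exists_cyclicallyReduced_conj (evalWord (C.letter v₀) g)
  obtain ⟨z, hz⟩ := exists_transport_eq_mul (evalWord (C.letter v₀) x)⁻¹ y
  set H := wordSubgroup (C.letter v₀) L
  obtain ⟨cf, hcf, havoid⟩ := exists_pathWord_powersAvoid (C := C) (H := H) hc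
  obtain ⟨yf, hyf⟩ := C.exists_pathWord y
  obtain ⟨zf, hzf⟩ := C.exists_pathWord z
  obtain ⟨s₀, hs₀, hbase⟩ := C.exists_isCanonical_coset_eq (H := H) v₀ (1 : A.FundamentalGroup v₀)
  obtain ⟨Fy, r, hFy, -, hyr, hrun_y⟩ := hyf.exists_arrows hs₀
  obtain ⟨Fz, p, hFz, -, hzp, hrun_z⟩ := hzf.exists_arrows hs₀
  have stabilizes_base : ∀ l ∈ L,
      (evalWord (C.letter v₀) l)⁻¹ • C.coset H v₀ s₀ = C.coset H v₀ s₀ := by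
    intro l hl
    have hmem : evalWord (C.letter v₀) l ∈ H := Subgroup.subset_closure ⟨l, hl, rfl⟩
    rw [hbase]
    exact QuotientGroup.eq.2 (by simpa using hmem)
  obtain ⟨F, S, hF, hsub, hL⟩ := exists_isFragment_stabilizes hs₀ stabilizes_base
    (List.forall_mem_append.2 ⟨hFy, hFz⟩)
  rw [List.append_subset] at hsub
  refine ⟨_, _, hF.valid, hL, a, zf, yf, cf, C.toPoint H S a p, C.toPoint H S a r, ?_, ?_,
    hrun_z S _ fun t ht => List.mem_map_of_mem (hsub.2 ht),
    hrun_y S _ fun t ht => List.mem_map_of_mem (hsub.1 ht),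
    havoid F S p r hF fun m hm hpr => ?_⟩
  · rw [evalWord_append, hzf.evalWord_eq, hyf.evalWord_eq, hz, mul_inv_cancel_left]
  · rw [evalWord_append, evalWord_append, hyf.evalWord_eq, hcf.evalWord_eq, hgy]
  · refine hI ⟨m, hm, ?_⟩
    rw [← hzp, ← hyr, hbase, smul_smul, ← mul_inv_rev, hz] at hpr
    have hmem := QuotientGroup.eq.1 hpr
    rw [eq_mul_inv_of_mul_eq hgy, conj_zpow]
    simpa [mul_assoc] using hmem

theorem refutable_iff [Finite A.EdgeElement] {I : PowerCosetQuery (Letter V K)} :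
    C.Refutable v₀ I ↔ ¬ PowerCoset (C.letter v₀) I :=
  ⟨fun h => h.not_powerCoset, refutable_of_not_powerCoset⟩

end Completeness

/-! ### Enumerating certificates -/

/-- The origin of a bundled edge, as a function without dependent types. -/
def edgeSource (e : TotalEdge V) : V := e.1

/-- The terminus of a bundled edge, as a function without dependent types. -/
def edgeTarget (e : TotalEdge V) : V := e.2.1

/-- The edge of an element of an edge group, as a function without dependent types. -/
def elementEdge (c : A.EdgeElement) : TotalEdge V := c.1

section Enumeration

variable {C}

theorem samePoint_iff_powerCoset {a : V} {x y : Point V K} :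
    C.SamePoint a x y ↔
      x.1 = y.1 ∧ PowerCoset (C.gen a) (x.2 ++ FreeGroup.invRev y.2, [], x.1.2) := by
  rw [← mem_wordSubgroup_iff_powerCoset, evalWord_append, evalWord_invRev]
  rfl

theorem powerHits_iff_powerCoset {a : V} {w : Word K} {x y : Point V K} :
    C.PowerHits a w x y ↔ x.1 = y.1 ∧ PowerCoset (C.gen a)
      (y.2 ++ FreeGroup.invRev x.2, y.2 ++ w ++ FreeGroup.invRev y.2, x.1.2) := by
  have hconj (g h k : A.vertexGroup a) (m : ℤ) :
      (h * g⁻¹)⁻¹ * (h * k * h⁻¹) ^ m = g * k ^ m * h⁻¹ := by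
    rw [conj_zpow]
    group
  simp only [PowerHits, PowerCoset, evalWord_append, evalWord_invRev, hconj]

section TraceStep

variable {E : List (Arrow V K)} {a : V} {e : TotalEdge V} {β : Bool}

theorem traceStep_inl_iff {s t : V × Option (Point V K)} {l : V × K} :
    C.TraceStep E s (Sum.inl l, β) t ↔
      s.1 = l.1 ∧ t = (s.1, s.2.map fun x => shift x [(l.2, β)]) := by
  obtain ⟨a, ζ⟩ := s
  constructor
  · rintro ⟨⟩
    exact ⟨rfl, rfl⟩
  · rintro ⟨rfl, rfl⟩
    exact TraceStep.vertex _ _ _ _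

theorem traceStep_inr_none_iff {t : V × Option (Point V K)} :
    C.TraceStep E (a, none) (Sum.inr e, β) t ↔
      β = true ∧ a = edgeSource e ∧ t = (edgeTarget e, none) := by
  constructor
  · rintro ⟨⟩
    exact ⟨rfl, rfl, rfl⟩
  · rintro ⟨rfl, rfl, rfl⟩
    exact TraceStep.dead _

theorem traceStep_inr_some_iff {x : Point V K} {t : V × Option (Point V K)} :
    C.TraceStep E (a, some x) (Sum.inr e, β) t ↔ β = true ∧ a = edgeSource e ∧
      ((∃ c : A.EdgeElement, elementEdge c = e ∧ ∃ t₀, t₀ ∈ E ∧ t₀.1 = e ∧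
        C.SamePoint a x (shift t₀.2.1 (C.αWord c)) ∧
        t = (edgeTarget e, some (shift t₀.2.2 (C.ωWord c)))) ∨
      t = (edgeTarget e, none) ∧ ∀ t₀ ∈ E, ∀ c : A.EdgeElement, t₀.1 = elementEdge c →
        elementEdge c = e → ¬ C.SamePoint a x (shift t₀.2.1 (C.αWord c))) := by
  constructor
  · intro h
    cases h with
    | edge e c x t₀ ht₀ he hx =>
      exact ⟨rfl, rfl, Or.inl ⟨⟨_, c⟩, rfl, t₀, ht₀, he, hx, rfl⟩⟩
    | stuck e x h => exact ⟨rfl, rfl, Or.inr ⟨rfl, h⟩⟩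
  · rintro ⟨rfl, rfl, ⟨⟨_, c⟩, rfl, t₀, ht₀, he, hx, rfl⟩ | ⟨rfl, h⟩⟩
    · exact TraceStep.edge _ c x t₀ ht₀ he hx
    · exact TraceStep.stuck _ x h

end TraceStep

theorem reducedStep_inl_iff {s t : V × Option (TotalEdge V) × Word K} {l : V × K} {β : Bool} :
    C.ReducedStep s (Sum.inl l, β) t ↔
      s.1 = l.1 ∧ t = (s.1, s.2.1, s.2.2 ++ [(l.2, β)]) := by
  obtain ⟨a, o, w⟩ := s
  constructor
  · rintro ⟨⟩
    exact ⟨rfl, rfl⟩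
  · rintro ⟨rfl, rfl⟩
    exact ReducedStep.vertex _ _ _ _ _

theorem reducedStep_inr_iff {s t : V × Option (TotalEdge V) × Word K} {e : TotalEdge V}
    {β : Bool} : C.ReducedStep s (Sum.inr e, β) t ↔
      β = true ∧ s.1 = edgeSource e ∧ t = (edgeTarget e, some e, []) ∧
        ∀ c : A.EdgeElement, s.2.1 = some (elementEdge c) → (elementEdge c).rev = e →
          ¬ PowerCoset (C.gen (edgeTarget (elementEdge c)))
            (s.2.2 ++ FreeGroup.invRev (C.ωWord c), [], []) := by
  obtain ⟨a, o, w⟩ := s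
  simp only [← evalWord_eq_iff_powerCoset]
  constructor
  · intro h
    cases h with
    | edge e o w h => exact ⟨rfl, rfl, rfl, h⟩
  · rintro ⟨rfl, rfl, rfl, h⟩
    exact ReducedStep.edge _ o w h

section Computability

variable {α : Type*} [Primcodable α] [Primcodable K]

theorem primrec_αWord_comp [Primcodable A.EdgeElement] [Finite A.EdgeElement] (C : A.Coding K)
    {f : α → A.EdgeElement} (hf : Primrec f) : Primrec fun x => C.αWord (f x) :=
  (Primrec.dom_finite C.αWord).comp hf

theorem primrec_ωWord_comp [Primcodable A.EdgeElement] [Finite A.EdgeElement] (C : A.Coding K)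
    {f : α → A.EdgeElement} (hf : Primrec f) : Primrec fun x => C.ωWord (f x) :=
  (Primrec.dom_finite C.ωWord).comp hf

variable [Primcodable V]

theorem rePred_powerCoset [Finite V] (hdec : ∀ a, ComputablePred (PowerCoset (C.gen a)))
    {f : α → V} {I : α → PowerCosetQuery K} (hf : Primrec f) (hI : Primrec I) :
    REPred fun x => PowerCoset (C.gen (f x)) (I x) :=
  rePred_comp (rePred_uncurry_of_finite fun a => (hdec a).to_re) (hI.pair hf).to_comp

theorem rePred_not_powerCoset [Finite V] (hdec : ∀ a, ComputablePred (PowerCoset (C.gen a)))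
    {f : α → V} {I : α → PowerCosetQuery K} (hf : Primrec f) (hI : Primrec I) :
    REPred fun x => ¬ PowerCoset (C.gen (f x)) (I x) :=
  rePred_comp (rePred_uncurry_of_finite fun a => (hdec a).not.to_re) (hI.pair hf).to_comp

variable [Primcodable (TotalEdge V)]

theorem primrec_vertexWord_comp {f : α → V} {g : α → Word K} (hf : Primrec f) (hg : Primrec g) :
    Primrec fun x => vertexWord (f x) (g x) :=
  Primrec.list_map hg (Primrec.to₂
    (f := fun y : α × K × Bool => ((Sum.inl (f y.1, y.2.1), y.2.2) : Letter V K × Bool))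
    (by fun_prop))

theorem primrec_shift_comp {f : α → Point V K} {g : α → Word K} (hf : Primrec f)
    (hg : Primrec g) : Primrec fun x => shift (f x) (g x) := by
  unfold shift
  fun_prop

section Edges

variable [Finite (TotalEdge V)]

theorem primrec_edgeSource_comp {f : α → TotalEdge V} (hf : Primrec f) :
    Primrec fun x => edgeSource (f x) :=
  (Primrec.dom_finite edgeSource).comp hf

theorem primrec_edgeTarget_comp {f : α → TotalEdge V} (hf : Primrec f) :
    Primrec fun x => edgeTarget (f x) :=
  (Primrec.dom_finite edgeTarget).comp hf

omit [Primcodable V] [Primcodable K] in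
theorem primrec_rev_comp {f : α → TotalEdge V} (hf : Primrec f) : Primrec fun x => (f x).rev :=
  (Primrec.dom_finite TotalEdge.rev).comp hf

theorem primrec_reverse_comp {f : α → Arrow V K} (hf : Primrec f) :
    Primrec fun x => (f x).reverse :=
  (primrec_rev_comp (by fun_prop)).pair (by fun_prop)

omit [Primcodable V] [Primcodable K] [Finite (TotalEdge V)] in
theorem primrec_elementEdge_comp [Primcodable A.EdgeElement] [Finite A.EdgeElement]
    {f : α → A.EdgeElement} (hf : Primrec f) : Primrec fun x => elementEdge (f x) :=
  (Primrec.dom_finite elementEdge).comp hf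

end Edges

attribute [fun_prop] primrec_αWord_comp primrec_ωWord_comp primrec_vertexWord_comp
  primrec_shift_comp primrec_edgeSource_comp primrec_edgeTarget_comp primrec_rev_comp
  primrec_reverse_comp primrec_elementEdge_comp

variable [Finite V] (hdec : ∀ a, ComputablePred (PowerCoset (C.gen a)))

include hdec

theorem rePred_samePoint {f : α → V} {g h : α → Point V K} (hf : Primrec f) (hg : Primrec g)
    (hh : Primrec h) : REPred fun x => C.SamePoint (f x) (g x) (h x) := by
  simp only [samePoint_iff_powerCoset]
  exact rePred_and (rePred_eq (by fun_prop) (by fun_prop))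
    (rePred_powerCoset hdec hf (by fun_prop))

theorem rePred_not_samePoint {f : α → V} {g h : α → Point V K} (hf : Primrec f) (hg : Primrec g)
    (hh : Primrec h) : REPred fun x => ¬ C.SamePoint (f x) (g x) (h x) := by
  simp only [samePoint_iff_powerCoset, not_and_or]
  exact rePred_or (rePred_ne (by fun_prop) (by fun_prop))
    (rePred_not_powerCoset hdec hf (by fun_prop))

theorem rePred_not_powerHits {f : α → V} {w : α → Word K} {g h : α → Point V K}
    (hf : Primrec f) (hw : Primrec w) (hg : Primrec g) (hh : Primrec h) :
    REPred fun x => ¬ C.PowerHits (f x) (w x) (g x) (h x) := by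
  simp only [powerHits_iff_powerCoset, not_and_or]
  exact rePred_or (rePred_ne (by fun_prop) (by fun_prop))
    (rePred_not_powerCoset hdec hf (by fun_prop))

variable [Finite (TotalEdge V)] [Primcodable A.EdgeElement] [Finite A.EdgeElement]

theorem rePred_valid {E : α → List (Arrow V K)} (hE : Primrec E) :
    REPred fun x => C.Valid (E x) := by
  have hclosed : REPred fun x => ∀ t ∈ E x, Arrow.reverse t ∈ E x :=
    rePred_forall_mem (rePred_mem (by fun_prop) (by fun_prop)) (by fun_prop)
  have hbijective : REPred fun x => ∀ t ∈ E x, ∀ t' ∈ E x, ∀ c : A.EdgeElement,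
      t.1 = elementEdge c → t'.1 = elementEdge c →
      C.SamePoint (edgeSource (elementEdge c)) (shift t.2.1 (C.αWord c)) t'.2.1 →
        C.SamePoint (edgeTarget (elementEdge c)) (shift t.2.2 (C.ωWord c)) t'.2.2 := by
    refine rePred_forall_mem (rePred_forall_mem (rePred_forall_finite
      (rePred_imp (rePred_ne ?_ ?_) (rePred_imp (rePred_ne ?_ ?_)
        (rePred_imp (rePred_not_samePoint hdec ?_ ?_ ?_) (rePred_samePoint hdec ?_ ?_ ?_)))))
      ?_) ?_ <;> fun_prop
  exact rePred_and hclosed hbijective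

theorem rePred_traceStep {E : α → List (Arrow V K)} {s t : α → V × Option (Point V K)}
    {l : α → Letter V K × Bool} (hE : Primrec E) (hs : Primrec s) (hl : Primrec l)
    (ht : Primrec t) : REPred fun x => C.TraceStep (E x) (s x) (l x) (t x) := by
  refine rePred_sum (p := fun x l' => C.TraceStep (E x) (s x) (l', (l x).2) (t x))
    ?_ ?_ (f := fun x => (l x).1) (by fun_prop)
  · have hshift : Primrec fun x : α × V × K =>
        (s x.1).2.map fun y => shift y [(x.2.2, (l x.1).2)] :=
      Primrec.option_map (by fun_prop) (primrec_shift_comp (f := Prod.snd)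
        (g := fun y : (α × V × K) × Point V K => [(y.1.2.2, (l y.1.1).2)])
        (by fun_prop) (by fun_prop)).to₂
    simp only [traceStep_inl_iff]
    exact rePred_and (rePred_eq (by fun_prop) (by fun_prop))
      (rePred_eq (by fun_prop) (by fun_prop))
  · refine rePred_option
      (p := fun (x : α × TotalEdge V) ζ =>
        C.TraceStep (E x.1) ((s x.1).1, ζ) (Sum.inr x.2, (l x.1).2) (t x.1))
      ?_ ?_ (f := fun x => (s x.1).2) (by fun_prop)
    · simp only [traceStep_inr_none_iff]
      refine rePred_and (rePred_eq ?_ ?_) (rePred_and (rePred_eq ?_ ?_) (rePred_eq ?_ ?_)) <;>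
        fun_prop
    · simp only [traceStep_inr_some_iff]
      refine rePred_and (rePred_eq ?_ ?_) (rePred_and (rePred_eq ?_ ?_) (rePred_or
        (rePred_exists (rePred_and (rePred_eq ?_ ?_) (rePred_exists (rePred_and (rePred_mem ?_ ?_)
          (rePred_and (rePred_eq ?_ ?_) (rePred_and (rePred_samePoint hdec ?_ ?_ ?_)
            (rePred_eq ?_ ?_)))))))
        (rePred_and (rePred_eq ?_ ?_) (rePred_forall_mem (rePred_forall_finite
          (rePred_imp (rePred_ne ?_ ?_) (rePred_imp (rePred_ne ?_ ?_)
            (rePred_not_samePoint hdec ?_ ?_ ?_)))) ?_)))) <;> fun_prop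

theorem rePred_run_traceStep {E : α → List (Arrow V K)} {s t : α → V × Option (Point V K)}
    {f : α → Word (Letter V K)} (hE : Primrec E) (hs : Primrec s) (hf : Primrec f)
    (ht : Primrec t) : REPred fun x => Run (C.TraceStep (E x)) (s x) (f x) (t x) :=
  rePred_run (R := fun x => C.TraceStep (E x))
    (rePred_traceStep hdec (by fun_prop) (by fun_prop) (by fun_prop) (by fun_prop))
    hs.to_comp hf.to_comp ht.to_comp

theorem rePred_reducedStep {s t : α → V × Option (TotalEdge V) × Word K}
    {l : α → Letter V K × Bool} (hs : Primrec s) (hl : Primrec l) (ht : Primrec t) :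
    REPred fun x => C.ReducedStep (s x) (l x) (t x) := by
  refine rePred_sum (p := fun x l' => C.ReducedStep (s x) (l', (l x).2) (t x))
    ?_ ?_ (f := fun x => (l x).1) (by fun_prop)
  · simp only [reducedStep_inl_iff]
    refine rePred_and (rePred_eq ?_ ?_) (rePred_eq ?_ ?_) <;> fun_prop
  · simp only [reducedStep_inr_iff]
    refine rePred_and (rePred_eq ?_ ?_) (rePred_and (rePred_eq ?_ ?_) (rePred_and
      (rePred_eq ?_ ?_) (rePred_forall_finite (rePred_imp (rePred_ne ?_ ?_)
        (rePred_imp (rePred_ne ?_ ?_) (rePred_not_powerCoset hdec ?_ ?_)))))) <;> fun_prop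

theorem rePred_isReducedWord {a b : α → V} {f : α → Word (Letter V K)} (ha : Primrec a)
    (hb : Primrec b) (hf : Primrec f) : REPred fun x => C.IsReducedWord (a x) (b x) (f x) :=
  rePred_exists (rePred_run (R := fun _ => C.ReducedStep)
    (rePred_reducedStep hdec (by fun_prop) (by fun_prop) (by fun_prop))
    (by fun_prop) (by fun_prop) (by fun_prop))

theorem rePred_evades {E : α → List (Arrow V K)} {a : α → V} {c : α → Word (Letter V K)}
    {p r : α → Point V K} (hE : Primrec E) (ha : Primrec a) (hc : Primrec c) (hp : Primrec p)
    (hr : Primrec r) : REPred fun x => C.Evades (E x) (a x) (c x) (p x) (r x) := by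
  refine rePred_exists (rePred_and (rePred_forall_mem (rePred_or
      (rePred_run_traceStep hdec ?_ ?_ ?_ ?_)
      (rePred_exists (rePred_and (rePred_mem ?_ ?_) (rePred_run_traceStep hdec ?_ ?_ ?_ ?_)))) ?_)
    (rePred_forall_mem (rePred_not_samePoint hdec ?_ ?_ ?_) ?_)) <;> fun_prop

theorem rePred_powersAvoid {E : α → List (Arrow V K)} {a : α → V} {c : α → Word (Letter V K)}
    {p r : α → Point V K} (hE : Primrec E) (ha : Primrec a) (hc : Primrec c) (hp : Primrec p)
    (hr : Primrec r) : REPred fun x => C.PowersAvoid (E x) (a x) (c x) (p x) (r x) := by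
  refine rePred_or (rePred_exists (rePred_and (rePred_eq ?_ ?_)
      (rePred_not_powerHits hdec ?_ ?_ ?_ ?_)))
    (rePred_and (rePred_isReducedWord hdec ?_ ?_ ?_) (rePred_and
      (rePred_isReducedWord hdec ?_ ?_ ?_) (rePred_and
        (rePred_evades hdec ?_ ?_ ?_ ?_ ?_) (rePred_evades hdec ?_ ?_ ?_ ?_ ?_)))) <;> fun_prop

variable {v₀ : V}
  (heq : REPred fun x : Word (Letter V K) × Word (Letter V K) =>
    evalWord (C.letter v₀) x.1 = evalWord (C.letter v₀) x.2)

include heq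

theorem rePred_stabilizes {E : α → List (Arrow V K)} {q : α → Point V K}
    {L : α → List (Word (Letter V K))} (hE : Primrec E) (hq : Primrec q) (hL : Primrec L) :
    REPred fun x => C.Stabilizes v₀ (E x) (q x) (L x) := by
  refine rePred_forall_mem (rePred_exists (rePred_exists
    (rePred_and (rePred_evalWord_eq heq ?_ ?_) (rePred_and (rePred_run_traceStep hdec ?_ ?_ ?_ ?_)
      (rePred_samePoint hdec ?_ ?_ ?_))))) ?_ <;> fun_prop

set_option synthInstance.maxSize 1000 in
theorem rePred_refutable : REPred (C.Refutable v₀) := by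
  refine rePred_exists (rePred_exists (rePred_and (rePred_valid hdec ?_) (rePred_and
    (rePred_stabilizes hdec heq ?_ ?_ ?_) (rePred_exists (rePred_exists (rePred_exists
      (rePred_exists (rePred_exists (rePred_exists
        (rePred_and (rePred_evalWord_eq heq ?_ ?_) (rePred_and (rePred_evalWord_eq heq ?_ ?_)
          (rePred_and (rePred_run_traceStep hdec ?_ ?_ ?_ ?_)
            (rePred_and (rePred_run_traceStep hdec ?_ ?_ ?_ ?_)
              (rePred_powersAvoid hdec ?_ ?_ ?_ ?_ ?_)))))))))))))) <;> fun_prop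

end Computability

end Enumeration
/-! ### The word problem -/

theorem evalWord_letter_vertexWord (v₀ a : V) (w : Word K) :
    evalWord (C.letter v₀) (vertexWord a w) = A.vertexHom v₀ a (evalWord (C.gen a) w) := by
  rw [(C.pathWord_vertexWord a w).evalWord_eq, vertexHom_apply]

/-- The relators of the vertex groups, and the relators `e ω_e(c) e' = α_e(c)` of the elementary
reductions. Here `e'` is the letter of the reverse edge; the case `c = 1` makes it the inverse of
`e`. -/
def relators : Set (Word (Letter V K)) :=
  {f | (∃ a w, evalWord (C.gen a) w = 1 ∧ f = vertexWord a w) ∨ ∃ c : A.EdgeElement,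
    f = [(Sum.inr c.1, true)] ++ vertexWord c.1.2.1 (C.ωWord c) ++ [(Sum.inr c.1.rev, true)] ++
      FreeGroup.invRev (vertexWord c.1.1 (C.αWord c))}

theorem evalWord_letter_of_mem_relators (v₀ : V) {f : Word (Letter V K)} (hf : f ∈ C.relators) :
    evalWord (C.letter v₀) f = 1 := by
  rcases hf with ⟨a, w, hw, rfl⟩ | ⟨⟨⟨a, b, e⟩, c⟩, rfl⟩
  · rw [evalWord_letter_vertexWord, hw, map_one]
  · simp only [evalWord_append, evalWord_invRev, evalWord_letter_vertexWord,
      evalWord_singleton_true, evalWord_αWord_mk, evalWord_ωWord_mk, mul_inv_eq_one]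
    exact edgeElement_mul_vertexHom_mul v₀ e c

/-- The group with the generators `Letter V K` and the relators `C.relators`. No relator collapses
a spanning tree, so this is not the fundamental group, but a word that spells a loop is trivial in
one of the two groups if and only if it is trivial in the other. -/
abbrev Presented := FreeGroup (Letter V K) ⧸ Subgroup.normalClosure (FreeGroup.mk '' C.relators)

/-- The generators of the presented group. -/
def presentedLetter (l : Letter V K) : C.Presented := QuotientGroup.mk (FreeGroup.of l)

theorem evalWord_presentedLetter_eq_one_iff {f : Word (Letter V K)} :
    evalWord C.presentedLetter f = 1 ↔
      FreeGroup.mk f ∈ Subgroup.normalClosure (FreeGroup.mk '' C.relators) := by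
  rw [← QuotientGroup.eq_one_iff, ← evalWord_freeGroup_of]
  exact Eq.congr_left
    (map_evalWord (QuotientGroup.mk' (Subgroup.normalClosure _)) FreeGroup.of f).symm

theorem evalWord_presentedLetter_of_mem_relators {f : Word (Letter V K)} (hf : f ∈ C.relators) :
    evalWord C.presentedLetter f = 1 :=
  C.evalWord_presentedLetter_eq_one_iff.2 (Subgroup.subset_normalClosure ⟨f, hf, rfl⟩)

theorem exists_presentedVertex (a : V) : ∃ φ : A.vertexGroup a →* C.Presented,
    ∀ w, φ (evalWord (C.gen a) w) = evalWord C.presentedLetter (vertexWord a w) := by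
  have hsurj : Function.Surjective (FreeGroup.lift (C.gen a)) := fun g =>
    (exists_evalWord (C.closure_gen a) g).imp' FreeGroup.mk fun _ hw => hw
  let ψ : FreeGroup K →* C.Presented := FreeGroup.lift fun k => C.presentedLetter (Sum.inl (a, k))
  have hψ (w : Word K) : ψ (FreeGroup.mk w) = evalWord C.presentedLetter (vertexWord a w) :=
    (evalWord_map C.presentedLetter (fun k => Sum.inl (a, k)) w).symm
  have hker : (FreeGroup.lift (C.gen a)).ker ≤ ψ.ker := by
    rintro ⟨w⟩ hw
    exact (hψ w).trans (C.evalWord_presentedLetter_of_mem_relators (Or.inl ⟨a, w, hw, rfl⟩))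
  exact ⟨(FreeGroup.lift (C.gen a)).liftOfSurjective hsurj ⟨ψ, hker⟩, fun w =>
    (MonoidHom.liftOfRightInverse_comp_apply _ _ _ _ _).trans (hψ w)⟩

/-- The homomorphism from a vertex group to the presented group. -/
noncomputable def presentedVertex (a : V) : A.vertexGroup a →* C.Presented :=
  (C.exists_presentedVertex a).choose

theorem presentedVertex_evalWord (a : V) (w : Word K) :
    C.presentedVertex a (evalWord (C.gen a) w) = evalWord C.presentedLetter (vertexWord a w) :=
  (C.exists_presentedVertex a).choose_spec w

/-- The value of a path in the presented group. -/
noncomputable def presentedPath : {a b : V} → A.GPath a b → C.Presented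
  | a, _, GPath.nil g => C.presentedVertex a g
  | a, _, @GPath.cons _ _ _ _ b _ g e p =>
    C.presentedVertex a g * C.presentedLetter (Sum.inr ⟨a, b, e⟩) * presentedPath p

theorem presentedPath_lmul {a b : V} (g : A.vertexGroup a) (p : A.GPath a b) :
    C.presentedPath (lmul g p) = C.presentedVertex a g * C.presentedPath p := by
  cases p <;> simp [lmul, presentedPath, mul_assoc]

theorem presentedLetter_mul_presentedVertex_mul {a b : V} (e : a ⟶ b) (c : A.edgeGroup e) :
    C.presentedLetter (Sum.inr ⟨a, b, e⟩) * C.presentedVertex b (A.ω e c) *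
      C.presentedLetter (Sum.inr ⟨b, a, Quiver.reverse e⟩) = C.presentedVertex a (A.α e c) := by
  have hrelator := C.evalWord_presentedLetter_of_mem_relators (Or.inr ⟨⟨⟨a, b, e⟩, c⟩, rfl⟩)
  simp only [evalWord_append, evalWord_invRev, evalWord_singleton_true, mul_inv_eq_one]
    at hrelator
  rw [← C.evalWord_αWord_mk, ← C.evalWord_ωWord_mk, presentedVertex_evalWord,
    presentedVertex_evalWord]
  exact hrelator

theorem presentedPath_eq_of_red {a b : V} {p q : A.GPath a b} (h : Red p q) :
    C.presentedPath p = C.presentedPath q := by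
  induction h with
  | head g e c p =>
    rw [presentedPath_lmul, map_mul, ← presentedLetter_mul_presentedVertex_mul]
    simp [presentedPath, mul_assoc]
  | tail g e _ ih => simp [presentedPath, ih]

theorem presentedPath_eq_of_equiv {a b : V} {p q : A.GPath a b} (h : GPath.Equiv p q) :
    C.presentedPath p = C.presentedPath q := by
  induction h with
  | rel p q h => exact C.presentedPath_eq_of_red h
  | refl p => rfl
  | symm p q _ ih => exact ih.symm
  | trans p q r _ _ ihpq ihqr => exact ihpq.trans ihqr

variable {C} in
theorem PathWord.presentedPath_eq {a b : V} {p : A.GPath a b} {f : Word (Letter V K)}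
    (h : C.PathWord p f) : C.presentedPath p = evalWord C.presentedLetter f := by
  induction h with
  | nil a => exact map_one (C.presentedVertex a)
  | @vertex a _ k β _ f _ ih =>
    rw [presentedPath_lmul, ih, presentedVertex_evalWord, evalWord_cons _ _ f]
    rfl
  | edge e _ ih =>
    rw [presentedPath, map_one, one_mul, ih, evalWord_cons C.presentedLetter,
      evalWord_singleton_true]

variable {C} in
theorem PathWord.evalWord_eq_one_iff {v₀ : V} {p : A.GPath v₀ v₀} {f : Word (Letter V K)}
    (h : C.PathWord p f) : evalWord (C.letter v₀) f = 1 ↔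
      FreeGroup.mk f ∈ Subgroup.normalClosure (FreeGroup.mk '' C.relators) := by
  constructor
  · intro hf
    rw [h.evalWord_eq, transport_loop] at hf
    have htrivial : GPath.Equiv p (GPath.nil 1) := loopClass_eq_iff.1 hf
    rw [← evalWord_presentedLetter_eq_one_iff, ← h.presentedPath_eq,
      C.presentedPath_eq_of_equiv htrivial]
    exact map_one (C.presentedVertex v₀)
  · suffices hle : Subgroup.normalClosure (FreeGroup.mk '' C.relators) ≤
        (FreeGroup.lift (C.letter v₀)).ker from fun hf => hle hf
    refine Subgroup.normalClosure_le_normal ?_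
    rintro _ ⟨r, hr, rfl⟩
    exact C.evalWord_letter_of_mem_relators v₀ hr

theorem exists_pathWord_flatMap (v₀ : V) : ∃ τ : Letter V K × Bool → Word (Letter V K),
    (∀ f, evalWord (C.letter v₀) (f.flatMap τ) = evalWord (C.letter v₀) f) ∧
      ∀ f : Word (Letter V K), ∃ p : A.GPath v₀ v₀, C.PathWord p (f.flatMap τ) := by
  choose p τ hτ hp using fun l => C.exists_loop_pathWord v₀ (evalWord (C.letter v₀) [l])
  refine ⟨τ, evalWord_flatMap _ _ _ fun l => ?_, fun f => ?_⟩
  · rw [(hτ l).evalWord_eq, transport_loop, hp]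
  · induction f with
    | nil => exact ⟨_, PathWord.nil v₀⟩
    | cons l f ih =>
      obtain ⟨q, hq⟩ := ih
      exact ⟨_, (hτ l).append hq⟩

section WordProblem

variable [Primcodable V] [Primcodable K] [Primcodable (TotalEdge V)] [Primcodable A.EdgeElement]
  [Finite V] [Finite (TotalEdge V)] [Finite A.EdgeElement] {C}

theorem rePred_relators (hdec : ∀ a, ComputablePred (PowerCoset (C.gen a))) :
    REPred fun f => f ∈ C.relators := by
  have hvertex : REPred fun f : Word (Letter V K) =>
      ∃ a w, PowerCoset (C.gen a) (w, [], []) ∧ f = vertexWord a w := by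
    refine rePred_exists (rePred_exists (rePred_and (rePred_powerCoset hdec ?_ ?_)
      (rePred_eq ?_ ?_))) <;> fun_prop
  have hedge : REPred fun f : Word (Letter V K) => ∃ c : A.EdgeElement,
      f = [(Sum.inr (elementEdge c), true)] ++
        vertexWord (edgeTarget (elementEdge c)) (C.ωWord c) ++
        [(Sum.inr (elementEdge c).rev, true)] ++
        FreeGroup.invRev (vertexWord (edgeSource (elementEdge c)) (C.αWord c)) := by
    refine rePred_exists (rePred_eq ?_ ?_) <;> fun_prop
  refine (rePred_or hvertex hedge).of_eq fun f => or_congr_left ?_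
  simp [← mem_wordSubgroup_iff_powerCoset, wordSubgroup]

theorem rePred_evalWord_letter_eq [Finite K]
    (hdec : ∀ a, ComputablePred (PowerCoset (C.gen a))) (v₀ : V) :
    REPred fun x : Word (Letter V K) × Word (Letter V K) =>
      evalWord (C.letter v₀) x.1 = evalWord (C.letter v₀) x.2 := by
  obtain ⟨τ, hτ, hloop⟩ := C.exists_pathWord_flatMap v₀
  have hquotient : Primrec fun x : Word (Letter V K) × Word (Letter V K) =>
      (x.1 ++ FreeGroup.invRev x.2).flatMap τ :=
    Primrec.list_flatMap (by fun_prop) ((Primrec.dom_finite τ).comp Primrec.snd).to₂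
  refine (rePred_comp (rePred_mk_mem_normalClosure (rePred_relators hdec))
    hquotient.to_comp).of_eq fun x => ?_
  obtain ⟨p, hp⟩ := hloop (x.1 ++ FreeGroup.invRev x.2)
  rw [← hp.evalWord_eq_one_iff, hτ, evalWord_append, evalWord_invRev, mul_inv_eq_one]

end WordProblem

end Coding

end GraphOfGroups

/-! ### Decidability -/

theorem exists_primcodable_of_finite (α : Type*) [Finite α] : Nonempty (Primcodable α) := by
  obtain ⟨n, ⟨e⟩⟩ := Finite.exists_equiv_fin α
  exact ⟨Primcodable.ofEquiv (Fin n) e⟩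

theorem DecidablePowerCosetMembership.exists_common_generators {ι : Type*} [Finite ι]
    {G : ι → Type*} [∀ a, Group (G a)] (h : ∀ a, DecidablePowerCosetMembership (G a)) :
    ∃ (N : ℕ) (t : ∀ a, Fin N → G a),
      ∀ a, Subgroup.closure (Set.range (t a)) = ⊤ ∧ ComputablePred (PowerCoset (t a)) := by
  choose n s hs hd using h
  obtain ⟨N, hN⟩ := (Set.finite_range n).bddAbove
  refine ⟨N, fun a i => if hi : i < n a then s a ⟨i, hi⟩ else 1, fun a => ⟨?_, ?_⟩⟩
  · rw [eq_top_iff, ← hs a]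
    refine Subgroup.closure_mono ?_
    rintro _ ⟨j, rfl⟩
    exact ⟨Fin.castLE (hN ⟨a, rfl⟩) j, by simp⟩
  · exact computablePred_powerCoset_of _ (hs a)
      ((hd a).of_eq fun I => powerCosetInstance_iff (s a) I)

theorem decidablePowerCosetMembership_of_rePred {ι G : Type*} [Group G] [Finite ι] [Primcodable ι]
    {s : ι → G} (hs : Subgroup.closure (Set.range s) = ⊤) (hyes : REPred (PowerCoset s))
    (hno : REPred fun I => ¬ PowerCoset s I) : DecidablePowerCosetMembership G := by
  obtain ⟨n, ⟨e⟩⟩ := Finite.exists_equiv_fin ι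
  refine ⟨n, s ∘ e.symm, by rwa [e.symm.surjective.range_comp], ?_⟩
  exact (computablePred_powerCoset_of (s ∘ e.symm) hs
    (ComputablePred.computable_iff_re_compl_re'.2 ⟨hyes, hno⟩)).of_eq fun I =>
      (powerCosetInstance_iff _ I).symm

theorem mainTheorem12 {V : Type u} [SerreGraph.{u, v} V] [Finite V] [∀ a b : V, Finite (a ⟶ b)]
    (A : GraphOfGroups.{u, v, w, x} V) (v₀ : V)
    (hedge : ∀ {a b : V} (e : a ⟶ b), Finite (A.edgeGroup e))
    (hvertex : ∀ a : V, DecidablePowerCosetMembership (A.vertexGroup a)) :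
    DecidablePowerCosetMembership (A.FundamentalGroup v₀) := by
  obtain ⟨N, t, ht⟩ := DecidablePowerCosetMembership.exists_common_generators hvertex
  obtain ⟨C, rfl⟩ := GraphOfGroups.exists_coding t fun a => (ht a).1
  have hdec : ∀ a, ComputablePred (PowerCoset (C.gen a)) := fun a => (ht a).2
  have : ∀ e : GraphOfGroups.TotalEdge V, Finite (A.edgeGroup e.2.2) := fun e => hedge e.2.2
  obtain ⟨_⟩ := exists_primcodable_of_finite V
  obtain ⟨_⟩ := exists_primcodable_of_finite (GraphOfGroups.TotalEdge V)
  obtain ⟨_⟩ := exists_primcodable_of_finite A.EdgeElement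
  have heq := GraphOfGroups.Coding.rePred_evalWord_letter_eq hdec v₀
  exact decidablePowerCosetMembership_of_rePred (C.closure_range_letter v₀)
    (rePred_powerCoset_of_evalWord_eq heq)
    ((GraphOfGroups.Coding.rePred_refutable hdec heq).of_eq fun I => C.refutable_iff)
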